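/- **Model.** Let $\lambda\in[0,1]$, $p_f\in[0,1]$, $p_d\in[0,1)$, $R,P_p,P_{s,\max}\in(0,\infty)$ and $\mu_{\min}\in\mathbb R$; put $R_p=(2^R-1)/P_p$ and assume $\mu_{\min}>p_de^{-R_p}$ and $$K=\frac1{R_p}\ln\!\Big(\frac{1-p_d}{\mu_{\min}-p_de^{-R_p}}\Big)-1>0 .$$ Let the channel gains $\alpha_{s,i},\beta_{s,i}$ $(i\ge1)$ and $\beta_p$ be i.i.d. exponential random variables with unit mean. For $a,p\ge0$ let $$\mu(a,p)=p_d\big(1-\Pr[\log_2(1+\alpha_pP_p)<R]\big)+(1-p_d)\Big(1-\Pr\Big[\log_2\Big(1+\frac{\alpha_pP_p}{1+ap}\Big)<R\Big]\Big),$$ with $\alpha_p$ exponential of unit mean, be the departure rate of the primary transmitter. Secondary transmitter $i$ uses the power $P_{s,i}=\min(P_{\mu,i},P_{s,\max})$, where $P_{\mu,i}=K/\alpha_{s,i}$, and has SNR $\gamma_{s,i}=P_{s,i}\beta_{s,i}$. **Scheduler.** With $N$ secondary transmitters let $\mathcal S=\{i\le N:P_{\mu,i}>P_{s,\max}\}$.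 The two-stage scheduler selects $i^\dagger=\arg\max_{i\in\mathcal S}\beta_{s,i}$ if $\mathcal S\ne\emptyset$, and $i^\dagger=\arg\max_{i\le N}\gamma_{s,i}$ if $\mathcal S=\emptyset$. **Average capacity.** For an event $A$ of positive probability put $\rho_A=\lambda/\mathbb E[\mu(\alpha_{s,i^\dagger},P_{s,i^\dagger})\mid A]$ (the fraction of slots in which the primary transmitter is busy) and $$C_A=\rho_A(1-p_d)\,\mathbb E\Big[\log_2\Big(1+\frac{\gamma_{s,i^\dagger}}{1+\beta_pP_p}\Big)\Big|A\Big]+(1-\rho_A)(1-p_f)\,\mathbb E\big[\log_2(1+\gamma_{s,i^\dagger})\,\big|\,A\big].$$ The average achievable capacity of the two-stage scheduler is $\mathbb E[C_{s,low}]=\Pr[\mathcal S=\emptyset]\,C_{\{\mathcal S=\emptyset\}}+\Pr[\mathcal S\neq\emptyset]\,C_{\{\mathcal S\ne\emptyset\}}$. **Theorem.** For every $N\ge1$ all the expectations above are finite, and almost surely the rates $\log_2(1+\gamma_{s,i^\dagger}/(1+\beta_pP_p))$ and $\log_2(1+\gamma_{s,i^\dagger})$ are at most the corresponding rates of the scheduler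 that selects $\arg\max_{i\le N}\gamma_{s,i}$. As $N\to\infty$, the difference between $\mathbb E[C_{s,low}]$ and the following expression tends to $0$: $$\begin{aligned} &w_N\Big[\tfrac{\lambda}{\mu_{\min}}(1-p_d)\big(\log_2(1+b_N)-\epsilon\big)+\big(1-\tfrac{\lambda}{\mu_{\min}}\big)(1-p_f)\log_2(1+b_N)\Big]\\ &+(1-w_N)\Big[\tfrac{\lambda}{M_{avg,l}}(1-p_d)\big(\ell_N-\epsilon\big)+\big(1-\tfrac{\lambda}{M_{avg,l}}\big)(1-p_f)\,\ell_N\Big], \end{aligned}$$ where $$w_N=e^{\frac{K}{P_{s,\max}\ln(1-1/N)}},\qquad b_N=P_{s,\max}\,\mathcal W\!\Big(\frac{KN}{P_{s,\max}}e^{K/P_{s,\max}}\Big)-K,\qquad \ell_N=\log_2\!\Big(1+P_{s,\max}\ln\!\big(N(1-e^{-K/P_{s,\max}})\big)\Big),$$ $$\epsilon=\frac{e^{1/P_p}E_1(1/P_p)}{\ln2},\qquad M_{avg,l}=p_de^{-R_p}+(1-p_d)\frac{\big(e^{K(R_pP_{s,\max}+1)/P_{s,\max}}-1\big)e^{-R_p(1+K)}}{\big(e^{K/P_{s,\max}}-1\big)\big(R_pP_{s,\max}+1\big)},$$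 $\mathcal W$ is the principal branch of the Lambert $W$ function and $E_1(x)=\int_x^\infty t^{-1}e^{-t}\,dt$. -/

import Mathlib

open MeasureTheory ProbabilityTheory Filter Topology

namespace CognitiveRadio

noncomputable section

/-- The principal branch of the Lambert `W` function: for `x ≥ -1/e`, the unique `w ≥ -1`
with `w * exp w = x`. -/
def lambertW (x : ℝ) : ℝ :=
  Function.invFunOn (fun w : ℝ => w * Real.exp w) (Set.Ici (-1)) x

/-- The exponential integral `E₁(x) = ∫_x^∞ e^{-t} / t dt` (for `x > 0`). -/
def expIntegralE1 (x : ℝ) : ℝ :=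
  ∫ t in Set.Ioi x, Real.exp (-t) / t

/-- The parameters of the primary and of the secondary network. -/
structure Params where
  /-- detection probability of the cooperative sensing -/
  pd : ℝ
  /-- false alarm probability of the cooperative sensing -/
  pf : ℝ
  /-- packet arrival rate at the primary transmitter -/
  lam : ℝ
  /-- minimum tolerable departure rate of the primary transmitter -/
  muMin : ℝ
  /-- transmit power of the primary transmitter -/
  Pp : ℝ
  /-- maximum transmit power of a secondary transmitter -/
  Psmax : ℝ
  /-- required rate at the primary receiver -/
  R : ℝ

/-- The links that matter for the secondary network; `ℕ` labels the secondary transmitters. -/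
inductive Link where
  /-- from the `i`th secondary transmitter to the primary receiver (gain `α_{s,i}`) -/
  | interf (i : ℕ) : Link
  /-- from the `i`th secondary transmitter to the secondary receiver (gain `β_{s,i}`) -/
  | forward (i : ℕ) : Link
  /-- from the primary transmitter to the secondary receiver (gain `β_p`) -/
  | primary : Link

namespace Params

variable (s : Params)

/-- `R_p = (2^R - 1) / P_p`. -/
def Rp : ℝ := ((2 : ℝ) ^ s.R - 1) / s.Pp

/-- Outage probability of the primary link under received interference power `I`; the gain
`α_p` of the primary link has the exponential law with unit mean. -/
def outage (I : ℝ) : ℝ :=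
  (expMeasure 1).real {x : ℝ | Real.logb 2 (1 + x * s.Pp / (1 + I)) < s.R}

/-- Departure rate `μ(a, p)` of the primary transmitter when the scheduled secondary transmitter
has interference gain `a` and transmit power `p`. -/
def departureRate (a p : ℝ) : ℝ :=
  s.pd * (1 - s.outage 0) + (1 - s.pd) * (1 - s.outage (a * p))

/-- The constant `K`. -/
def K : ℝ :=
  1 / s.Rp * Real.log ((1 - s.pd) / (s.muMin - s.pd * Real.exp (-s.Rp))) - 1

/-- The power `P_μ` at interference gain `a`, for which the departure rate is `μ_min`. -/
def Pmu (a : ℝ) : ℝ := 1 / a * s.K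

/-- Transmit power of a secondary transmitter with interference gain `a`. -/
def txPower (a : ℝ) : ℝ :=
  if s.Pmu a < 0 then 0 else if s.Pmu a < s.Psmax then s.Pmu a else s.Psmax

/-- Received SNR of a secondary transmitter with interference gain `a` and forward gain `b`. -/
def snr (a b : ℝ) : ℝ := s.txPower a * b

/-- The candidate set `S` of the first stage, among the transmitters `0, …, N - 1`. -/
def candidates (N : ℕ) (a : ℕ → ℝ) : Finset ℕ :=
  {i ∈ Finset.range N | s.Psmax < s.Pmu (a i)}

/-- `i` has the largest SNR among the `N` transmitters. -/
def IsLargestSNR (N : ℕ) (a b : ℕ → ℝ) (i : ℕ) : Prop :=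
  i ∈ Finset.range N ∧ ∀ j ∈ Finset.range N, s.snr (a j) (b j) ≤ s.snr (a i) (b i)

/-- `i` is a choice of the two-stage scheduler: the largest forward gain in the candidate set if
that set is nonempty, otherwise the largest SNR among all `N` transmitters. -/
def IsTwoStageChoice (N : ℕ) (a b : ℕ → ℝ) (i : ℕ) : Prop :=
  ((s.candidates N a).Nonempty →
    i ∈ s.candidates N a ∧ ∀ j ∈ s.candidates N a, b j ≤ b i) ∧
  (s.candidates N a = ∅ → s.IsLargestSNR N a b i)

/-- Rate of a secondary transmission without primary interference. -/
def rateIdle (a b : ℝ) : ℝ := Real.logb 2 (1 + s.snr a b)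

/-- Rate of a secondary transmission under primary interference with gain `bp`. -/
def rateBusy (a b bp : ℝ) : ℝ := Real.logb 2 (1 + s.snr a b / (1 + bp * s.Pp))

/-- Mean capacity when the primary transmitter is busy with probability `ρ`, the secondary
network then gets mean rate `r₁` upon a missed detection, and it gets mean rate `r₀` in an idle
slot without a false alarm. -/
def meanCapacity (ρ r₁ r₀ : ℝ) : ℝ :=
  ρ * (1 - s.pd) * r₁ + (1 - ρ) * (1 - s.pf) * r₀

section Random

variable {Ω : Type*} [MeasurableSpace Ω] (P : Measure Ω) (g : Link → Ω → ℝ)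

/-- Departure rate of the primary transmitter when `σ ω` is scheduled with its own power. -/
def schedDeparture (σ : Ω → ℕ) (ω : Ω) : ℝ :=
  s.departureRate (g (.interf (σ ω)) ω) (s.txPower (g (.interf (σ ω)) ω))

/-- Rate of the scheduled transmitter `σ ω` without primary interference. -/
def schedRateIdle (σ : Ω → ℕ) (ω : Ω) : ℝ :=
  s.rateIdle (g (.interf (σ ω)) ω) (g (.forward (σ ω)) ω)

/-- Rate of the scheduled transmitter `σ ω` under primary interference. -/
def schedRateBusy (σ : Ω → ℕ) (ω : Ω) : ℝ :=
  s.rateBusy (g (.interf (σ ω)) ω) (g (.forward (σ ω)) ω) (g .primary ω)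

/-- The event that no transmitter saturates: `max_i P_{μ,i} ≤ P_{s,max}`. -/
def unsaturated (N : ℕ) : Set Ω :=
  {ω | s.candidates N (fun i => g (.interf i) ω) = ∅}

/-- Average capacity of the schedule `σ` conditioned on the event `A`. The primary transmitter is
busy with probability arrival rate / mean departure rate, the latter conditioned on `A`. -/
def condCapacity (σ : Ω → ℕ) (A : Set Ω) : ℝ :=
  s.meanCapacity (s.lam / ∫ ω, s.schedDeparture g σ ω ∂P[|A])
    (∫ ω, s.schedRateBusy g σ ω ∂P[|A]) (∫ ω, s.schedRateIdle g σ ω ∂P[|A])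

/-- Average achievable capacity of the schedule `σ` with `N` secondary transmitters, split
according to whether some transmitter saturates at the maximum power. -/
def avgCapacity (N : ℕ) (σ : Ω → ℕ) : ℝ :=
  P.real (s.unsaturated g N) * s.condCapacity P g σ (s.unsaturated g N) +
  P.real (s.unsaturated g N)ᶜ * s.condCapacity P g σ (s.unsaturated g N)ᶜ

end Random

/-- `b_{N,low1} = P_{s,max} W((K N / P_{s,max}) e^{K / P_{s,max}}) - K`. -/
def bLow (N : ℕ) : ℝ :=
  s.Psmax * lambertW (s.K * N / s.Psmax * Real.exp (s.K / s.Psmax)) - s.K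

/-- The constant `M_{avg,l}`. -/
def Mavg : ℝ :=
  s.pd * Real.exp (-s.Rp) + (1 - s.pd) *
    ((Real.exp (s.K * (s.Rp * s.Psmax + 1) / s.Psmax) - 1) * Real.exp (-s.Rp * (1 + s.K)) /
      ((Real.exp (s.K / s.Psmax) - 1) * (s.Rp * s.Psmax + 1)))

/-- The weight `e^{K / (P_{s,max} ln(1 - 1/N))}`. -/
def weight (N : ℕ) : ℝ :=
  Real.exp (s.K / (s.Psmax * Real.log (1 - 1 / (N : ℝ))))

/-- The correction `e^{1/P_p} E₁(1/P_p) / ln 2` for the primary interference. -/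
def interfLoss : ℝ :=
  Real.exp (1 / s.Pp) * expIntegralE1 (1 / s.Pp) / Real.log 2

/-- The explicit asymptotic expression for the average capacity of the two-stage scheduler. -/
def asympCapacity (N : ℕ) : ℝ :=
  s.weight N *
    (s.lam / s.muMin * (1 - s.pd) * (Real.logb 2 (1 + s.bLow N) - s.interfLoss) +
      (1 - s.lam / s.muMin) * (1 - s.pf) * Real.logb 2 (1 + s.bLow N)) +
  (1 - s.weight N) *
    (s.lam / s.Mavg * (1 - s.pd) *
        (Real.logb 2 (1 + s.Psmax * Real.log (N * (1 - Real.exp (-s.K / s.Psmax))))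
          - s.interfLoss) +
      (1 - s.lam / s.Mavg) * (1 - s.pf) *
        Real.logb 2 (1 + s.Psmax * Real.log (N * (1 - Real.exp (-s.K / s.Psmax)))))

end Params

end

end CognitiveRadio

open CognitiveRadio

namespace CognitiveRadio

open Set

/-! ### The exponential law with unit mean -/

/-! Put c = K / P_{s,max}. For positive gains, a transmitter belongs to the candidate set exactly
when its interference gain is below c, and it then sends at full power. Otherwise its received
interference is exactly K, the value at which the departure rate equals μ_min. Both conditional mean
departure rates are therefore exact for every N ≥ 1. On `noCandidate` the rate is the constant
μ_min. On its complement the winner is chosen among the candidates by forward gains alone, so its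
interference gain keeps the exponential law conditioned to lie below c (`sum_setIntegral_isBest`),
and the mean departure rate is `Mavg`.

Only the rates need asymptotics. The event without candidates has probability e^{-cN}, while the
mean rate on it is at most linear in N, so its contribution vanishes. So does the first term of the
explicit expression: the weight is at most e^{-c(N-1)} (`weight_le`), and a crude linear bound on
b_N suffices (`bLow_mem_Icc`). No finer property of the Lambert function is used.

On the complement the SNR is P_{s,max} M, where M is the best candidate gain. Let d = ln(N(1 -
e^{-c})), so that N(1 - e^{-c}) = e^d. The tangent to the logarithm at d together with E(M - d)^+ ≤
1 bounds E log(1 + pM) from above (`integral_log_one_add_bestGain_le`). The bound P(M < d - ln d) ≤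
e^{-d} gives a matching lower bound (`le_integral_log_one_add_bestGain`). Under primary interference
qZ, the logarithmic rate is log(1 + pM) - log(1 + qZ) plus log(1 + qZ/(1 + pM)). The mean of log(1 +
qZ) is e^{1/q} E_1(1/q), and the last term vanishes in mean because M is large with high probability
(`abs_integral_log_one_add_bestGain_div_sub_le`).

The schedule is not assumed measurable. Almost surely, however, its rates and departure rate
coincide with explicit measurable functions of the gains (`schedule_ae_eq`), so everything is
computed under the product law `gainLaw`. -/

instance isProbabilityMeasure_expMeasure_one : IsProbabilityMeasure (expMeasure 1) :=
  isProbabilityMeasure_expMeasure one_pos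

theorem expMeasure_one_eq_withDensity :
    expMeasure 1 =
      (volume.restrict (Ioi (0 : ℝ))).withDensity fun x => ENNReal.ofReal (Real.exp (-x)) := by
  rw [← Measure.restrict_congr_set (Ioi_ae_eq_Ici (μ := volume)).symm, ← withDensity_indicator measurableSet_Ici]
  change volume.withDensity (exponentialPDF 1) = _
  congr 1
  ext x
  by_cases hx : 0 ≤ x
  · simp [exponentialPDF_eq, hx]
  · simp [exponentialPDF_eq, hx]

theorem integral_expMeasure_one (f : ℝ → ℝ) :
    ∫ x, f x ∂expMeasure 1 = ∫ x in Ioi 0, Real.exp (-x) * f x := by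
  rw [expMeasure_one_eq_withDensity, integral_withDensity_eq_integral_toReal_smul
    (by fun_prop) (by simp)]
  simp [ENNReal.toReal_ofReal, Real.exp_nonneg]

theorem integrable_expMeasure_one_iff {f : ℝ → ℝ} :
    Integrable f (expMeasure 1) ↔ IntegrableOn (fun x => Real.exp (-x) * f x) (Ioi 0) := by
  rw [expMeasure_one_eq_withDensity, integrable_withDensity_iff_integrable_smul'
    (by fun_prop) (by simp)]
  simp [ENNReal.toReal_ofReal, Real.exp_nonneg, IntegrableOn]

instance nullSingletonClass_expMeasure_one : NullSingletonClass (expMeasure 1) := by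
  rw [expMeasure_one_eq_withDensity]
  exact ⟨fun x => withDensity_absolutelyContinuous _ _ (measure_singleton x)⟩

theorem ae_pos_expMeasure_one : ∀ᵐ x ∂expMeasure 1, 0 < x := by
  rw [expMeasure_one_eq_withDensity]
  exact (withDensity_absolutelyContinuous _ _).ae_le (ae_restrict_mem measurableSet_Ioi)

theorem expMeasure_one_real_Iio {y : ℝ} (hy : 0 ≤ y) :
    (expMeasure 1).real (Iio y) = 1 - Real.exp (-y) := by
  rw [measureReal_congr Iio_ae_eq_Iic, ← cdf_eq_real, cdf_expMeasure_eq one_pos]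
  simp [hy]

theorem expMeasure_one_real_Ici {y : ℝ} (hy : 0 ≤ y) :
    (expMeasure 1).real (Ici y) = Real.exp (-y) := by
  rw [← compl_Iio, probReal_compl_eq_one_sub measurableSet_Iio, expMeasure_one_real_Iio hy]
  ring

theorem tendsto_add_mul_exp_neg (d : ℝ) :
    Tendsto (fun x : ℝ => (x + d) * Real.exp (-x)) atTop (𝓝 0) := by
  have h1 : Tendsto (fun x : ℝ => x * Real.exp (-x)) atTop (𝓝 0) := by
    simpa using Real.tendsto_pow_mul_exp_neg_atTop_nhds_zero 1
  have h2 := Real.tendsto_exp_neg_atTop_nhds_zero.const_mul d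
  simpa [add_mul] using h1.add h2

/-- This antiderivative serves both the integrability and the value of the mean excess over d; d = 0
covers the first moment. -/
theorem hasDerivAt_neg_add_mul_exp_neg (d x : ℝ) :
    HasDerivAt (fun x : ℝ => -((x + (1 - d)) * Real.exp (-x))) (Real.exp (-x) * (x - d)) x := by
  have h := (((hasDerivAt_id x).add_const (1 - d)).mul (hasDerivAt_id x).neg.exp).neg
  refine h.congr_deriv ?_
  simp
  ring

theorem integrableOn_exp_neg_mul_sub (d : ℝ) :
    IntegrableOn (fun x : ℝ => Real.exp (-x) * (x - d)) (Ioi d) :=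
  integrableOn_Ioi_deriv_of_nonneg' (fun x _ => hasDerivAt_neg_add_mul_exp_neg d x)
    (fun _ hx => mul_nonneg (Real.exp_nonneg _) (sub_nonneg.2 (le_of_lt hx)))
    (tendsto_add_mul_exp_neg (1 - d)).neg

theorem integrable_id_expMeasure_one : Integrable (fun x : ℝ => x) (expMeasure 1) := by
  rw [integrable_expMeasure_one_iff]
  simpa using integrableOn_exp_neg_mul_sub 0

/-- Memorylessness: the level d is exceeded with probability e^{-d}, and the excess then has unit
mean again. -/
theorem integral_max_sub_expMeasure_one {d : ℝ} (hd : 0 ≤ d) :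
    ∫ x, max (x - d) 0 ∂expMeasure 1 = Real.exp (-d) := by
  rw [integral_expMeasure_one]
  have h : ∀ x, Real.exp (-x) * max (x - d) 0 =
      (Ioi d).indicator (fun x => Real.exp (-x) * (x - d)) x := by
    intro x
    by_cases hx : d < x
    · simp [hx, hx.le]
    · simp [hx, not_lt.1 hx]
  simp_rw [h]
  rw [setIntegral_indicator measurableSet_Ioi, Ioi_inter_Ioi, max_eq_right hd,
    integral_Ioi_of_hasDerivAt_of_nonneg' (fun x _ => hasDerivAt_neg_add_mul_exp_neg d x)
      (fun x hx => mul_nonneg (Real.exp_nonneg _) (sub_nonneg.2 (le_of_lt hx)))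
      (tendsto_add_mul_exp_neg (1 - d)).neg]
  simp

theorem integral_id_expMeasure_one : ∫ x, x ∂expMeasure 1 = 1 := by
  have h := integral_max_sub_expMeasure_one (le_refl 0)
  rw [neg_zero, Real.exp_zero] at h
  refine Eq.trans (integral_congr_ae ?_) h
  filter_upwards [ae_pos_expMeasure_one] with x hx
  simp [hx.le]

/-- The Laplace transform of the exponential law, truncated at `d`. -/
theorem integral_indicator_exp_expMeasure_one {r d : ℝ} (hr : 0 ≤ r) (hd : 0 ≤ d) :
    ∫ x, (Iio d).indicator (fun x => Real.exp (-(r * x))) x ∂expMeasure 1 =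
      (1 - Real.exp (-((1 + r) * d))) / (1 + r) := by
  have hr1 : 1 + r ≠ 0 := by positivity
  rw [integral_expMeasure_one]
  have h : ∀ x, Real.exp (-x) * (Iio d).indicator (fun x => Real.exp (-(r * x))) x =
      (Iio d).indicator (fun x => Real.exp (-((1 + r) * x))) x := by
    intro x
    by_cases hx : x < d
    · simp only [mem_Iio, hx, indicator_of_mem, ← Real.exp_add]
      congr 1
      ring
    · simp [hx]
  simp_rw [h]
  rw [setIntegral_indicator measurableSet_Iio, Ioi_inter_Iio, ← integral_Ioc_eq_integral_Ioo,
    ← intervalIntegral.integral_of_le hd,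
    intervalIntegral.integral_eq_sub_of_hasDerivAt
      (f := fun x => -(Real.exp (-((1 + r) * x)) / (1 + r)))]
  · simp
    ring
  · intro x _
    have h := ((((hasDerivAt_id x).const_mul (1 + r)).neg.exp).div_const (1 + r)).neg
    refine h.congr_deriv ?_
    simp
    field_simp
    ring
  · exact (by fun_prop : Continuous _).intervalIntegrable _ _

/-! ### Logarithmic moments of the exponential law -/

theorem log_one_add_le_self {y : ℝ} (hy : 0 ≤ y) : Real.log (1 + y) ≤ y := by
  have := Real.log_le_sub_one_of_pos (by linarith : 0 < 1 + y)
  linarith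

theorem integrable_log_one_add_mul_expMeasure_one {p : ℝ} (hp : 0 < p) :
    Integrable (fun x => Real.log (1 + x * p)) (expMeasure 1) := by
  refine (integrable_id_expMeasure_one.mul_const p).mono'
    (by fun_prop : Measurable _).aestronglyMeasurable ?_
  filter_upwards [ae_pos_expMeasure_one] with x hx
  have hxp : 0 ≤ x * p := by positivity
  rw [Real.norm_of_nonneg (Real.log_nonneg (by linarith))]
  exact log_one_add_le_self hxp

/-- Integration by parts replaces the logarithm by p/(1 + px) = 1/(x + 1/p), and the shift t = x +
1/p then produces E_1. -/
theorem integral_log_one_add_mul_expMeasure_one {p : ℝ} (hp : 0 < p) :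
    ∫ x, Real.log (1 + x * p) ∂expMeasure 1 = Real.exp (1 / p) * expIntegralE1 (1 / p) := by
  have hpos : ∀ x ∈ Ici (0 : ℝ), 0 < 1 + x * p := fun x hx => by
    have : (0 : ℝ) ≤ x := hx
    positivity
  have hI1 := integrable_expMeasure_one_iff.1 (integrable_log_one_add_mul_expMeasure_one hp)
  have hI2 : IntegrableOn (fun x => Real.exp (-x) * (p / (1 + x * p))) (Ioi 0) := by
    refine ((exp_neg_integrableOn_Ioi 0 one_pos).mul_const p).mono'
      (by fun_prop : Measurable _).aestronglyMeasurable ?_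
    filter_upwards [ae_restrict_mem measurableSet_Ioi] with x hx
    have hx0 : (0 : ℝ) < x := hx
    rw [Real.norm_of_nonneg (by positivity), neg_one_mul]
    gcongr
    exact div_le_self hp.le (by nlinarith)
  have hlim : Tendsto (fun x => -(Real.exp (-x) * Real.log (1 + x * p))) atTop (𝓝 0) := by
    rw [← neg_zero]
    refine Tendsto.neg (squeeze_zero' (g := fun x => p * ((x + 0) * Real.exp (-x))) ?_ ?_ ?_)
    · filter_upwards [eventually_ge_atTop 0] with x hx
      exact mul_nonneg (Real.exp_nonneg _) (Real.log_nonneg (by nlinarith))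
    · filter_upwards [eventually_ge_atTop 0] with x hx
      have := log_one_add_le_self (by positivity : 0 ≤ x * p)
      nlinarith [Real.exp_pos (-x)]
    · simpa using (tendsto_add_mul_exp_neg 0).const_mul p
  have hparts : ∫ x in Ioi 0, (Real.exp (-x) * Real.log (1 + x * p) -
      Real.exp (-x) * (p / (1 + x * p))) = 0 - -(Real.exp (-0) * Real.log (1 + 0 * p)) := by
    refine integral_Ioi_of_hasDerivAt_of_tendsto'
      (f := fun x => -(Real.exp (-x) * Real.log (1 + x * p))) ?_ (hI1.sub hI2) hlim
    intro x hx
    have h1 : HasDerivAt (fun x => 1 + x * p) p x := by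
      simpa using ((hasDerivAt_id x).mul_const p).const_add 1
    have h := ((hasDerivAt_id x).neg.exp.mul (h1.log (hpos x hx).ne')).neg
    refine h.congr_deriv ?_
    simp
    ring
  rw [integral_sub hI1 hI2] at hparts
  rw [integral_expMeasure_one]
  have hsub : ∫ x in Ioi 0, Real.exp (-x) * (p / (1 + x * p)) =
      ∫ x in Ioi 0, Real.exp (1 / p) * (Real.exp (-(x + 1 / p)) / (x + 1 / p)) := by
    refine setIntegral_congr_fun measurableSet_Ioi fun x hx => ?_
    have hx0 : (0 : ℝ) < x := hx
    have h2 : Real.exp (-x) = Real.exp (1 / p) * Real.exp (-(x + 1 / p)) := by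
      rw [← Real.exp_add]
      congr 1
      ring
    have h3 : p / (1 + x * p) = 1 / (x + 1 / p) := by
      have := hpos x hx0.le
      field_simp
      ring
    simp only [h2, h3]
    ring
  have hshift : ∫ x in Ioi 0, Real.exp (-(x + 1 / p)) / (x + 1 / p) = expIntegralE1 (1 / p) := by
    rw [expIntegralE1]
    have h := (measurePreserving_add_right volume (1 / p)).setIntegral_preimage_emb
      (measurableEmbedding_addRight (1 / p)) (fun t : ℝ => Real.exp (-t) / t) (Ioi (1 / p))
    simpa using h
  rw [integral_const_mul, hshift] at hsub
  rw [← hsub]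
  simp at hparts
  linarith

/-! ### The joint law of the channel gains -/

/-- Countability lets almost sure statements about single links be combined over all links. -/
instance countable_link : Countable Link := by
  have : Function.Injective (fun l : Link => match l with
      | .interf i => (some (i, true) : Option (ℕ × Bool))
      | .forward i => some (i, false)
      | .primary => none) := by
    intro l l' h
    cases l <;> cases l' <;> simp_all
  exact this.countable

/-- The joint law of independent channel gains, exponential with unit mean. -/
noncomputable abbrev gainLaw : Measure (Link → ℝ) := Measure.infinitePi fun _ => expMeasure 1

theorem measurePreserving_eval_gainLaw (l : Link) :
    MeasurePreserving (fun x : Link → ℝ => x l) gainLaw (expMeasure 1) :=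
  measurePreserving_eval_infinitePi _ l

theorem integral_comp_eval_gainLaw {φ : ℝ → ℝ} (hφ : Measurable φ) (l : Link) :
    ∫ x, φ (x l) ∂gainLaw = ∫ y, φ y ∂expMeasure 1 := by
  rw [← (measurePreserving_eval_gainLaw l).map_eq, integral_map (measurable_pi_apply l).aemeasurable
    hφ.aestronglyMeasurable]

/-- Setting the coordinates outside S to zero does not change f, and this truncation is measurable
for the σ-algebra generated by the coordinates in S. Independence claims thereby reduce to checking
which links a function depends on. -/
theorem measurable_iSup_comap_of_dependsOn {β : Type*} [MeasurableSpace β]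
    {f : (Link → ℝ) → β} (hf : Measurable f) {S : Set Link} (hS : DependsOn f S) :
    Measurable[⨆ l ∈ S, MeasurableSpace.comap (fun x : Link → ℝ => x l) inferInstance] f := by
  classical
  have hcomp : f = f ∘ fun x : Link → ℝ => S.indicator x := by
    ext x
    exact hS fun l hl => by simp [hl]
  rw [hcomp]
  refine @Measurable.comp _ _ _ (_) _ _ _ _ hf (@measurable_pi_lambda _ _ _ (_) _ _ fun l => ?_)
  by_cases hl : l ∈ S
  · simp only [hl, indicator_of_mem]
    rw [measurable_iff_comap_le]
    exact le_iSup₂_of_le l hl le_rfl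
  · simp only [hl, not_false_iff, indicator_of_notMem]
    exact measurable_const

theorem indepFun_gainLaw_of_dependsOn {β γ : Type*} [MeasurableSpace β] [MeasurableSpace γ]
    {f : (Link → ℝ) → β} {g : (Link → ℝ) → γ} (hf : Measurable f) (hg : Measurable g)
    {S T : Set Link} (hfS : DependsOn f S) (hgT : DependsOn g T) (hST : Disjoint S T) :
    IndepFun f g gainLaw := by
  have hind : iIndepFun (fun (l : Link) (x : Link → ℝ) => x l) gainLaw :=
    iIndepFun_infinitePi (X := fun _ y => y) fun _ => measurable_id
  have h := indep_iSup_of_disjoint (fun l => (measurable_pi_apply l).comap_le) hind.iIndep hST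
  rw [IndepFun_iff_Indep]
  exact indep_of_indep_of_le_left
    (indep_of_indep_of_le_right h (measurable_iSup_comap_of_dependsOn hg hgT).comap_le)
    (measurable_iSup_comap_of_dependsOn hf hfS).comap_le

theorem gainLaw_real_inter_of_dependsOn {A B : Set (Link → ℝ)} (hA : MeasurableSet A)
    (hB : MeasurableSet B) {S T : Set Link} (hAS : DependsOn (· ∈ A) S)
    (hBT : DependsOn (· ∈ B) T) (hST : Disjoint S T) :
    gainLaw.real (A ∩ B) = gainLaw.real A * gainLaw.real B := by
  have h := (indepFun_gainLaw_of_dependsOn (f := (· ∈ A)) (g := (· ∈ B)) hA.mem hB.mem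
    hAS hBT hST).measure_inter_preimage_eq_mul {True} {True} trivial trivial
  have e : ∀ C : Set (Link → ℝ), (· ∈ C) ⁻¹' {True} = C := fun C => by ext; simp
  rw [e, e] at h
  simp [Measure.real, h]

theorem setIntegral_gainLaw_of_dependsOn {φ : ℝ → ℝ} (hφ : Measurable φ) {B : Set (Link → ℝ)}
    (hB : MeasurableSet B) {l : Link} {T : Set Link} (hBT : DependsOn (· ∈ B) T) (hl : l ∉ T) :
    ∫ x in B, φ (x l) ∂gainLaw = (∫ y, φ y ∂expMeasure 1) * gainLaw.real B := by
  have hdep : DependsOn (fun x => B.indicator (fun _ => (1 : ℝ)) x) T := by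
    classical
    intro x y hxy
    have := hBT hxy
    simp only [eq_iff_iff] at this
    simp [indicator_apply, this]
  have h := (indepFun_gainLaw_of_dependsOn (f := fun x => φ (x l))
    (g := fun x => B.indicator (fun _ => (1 : ℝ)) x) (by fun_prop)
    (measurable_const.indicator hB) (S := {l}) (fun x y hxy => by simp [hxy l rfl]) hdep
    (by simpa using hl)).integral_fun_mul_eq_mul_integral
    (by fun_prop : Measurable _).aestronglyMeasurable
    (measurable_const.indicator hB).aestronglyMeasurable
  rw [integral_indicator hB] at h
  rw [integral_comp_eval_gainLaw hφ] at h
  rw [← integral_indicator hB]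
  simp at h
  rw [← h]
  congr 1
  ext x
  by_cases hx : x ∈ B <;> simp [hx]

/-- Different transmitters use disjoint pairs of links, so the events are independent and the last
one splits off by induction. -/
theorem gainLaw_real_forall_pair {B : Set (ℝ × ℝ)} (hB : MeasurableSet B) (N : ℕ) :
    gainLaw.real {x | ∀ i < N, (x (.interf i), x (.forward i)) ∈ B} =
      ((expMeasure 1).prod (expMeasure 1)).real B ^ N := by
  induction N with
  | zero => simp
  | succ N ih =>
    have hset : {x : Link → ℝ | ∀ i < N + 1, (x (.interf i), x (.forward i)) ∈ B} =
        {x | ∀ i < N, (x (.interf i), x (.forward i)) ∈ B} ∩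
          {x | (x (.interf N), x (.forward N)) ∈ B} := by
      ext x
      exact Nat.forall_lt_succ_right
    have hm : ∀ i, MeasurableSet {x : Link → ℝ | (x (.interf i), x (.forward i)) ∈ B} := fun i =>
      (by fun_prop : Measurable fun x : Link → ℝ => (x (.interf i), x (.forward i))) hB
    have hpair : gainLaw.real {x | (x (.interf N), x (.forward N)) ∈ B} =
        ((expMeasure 1).prod (expMeasure 1)).real B := by
      rw [← Measure.infinitePi_map_eval_prod (P := fun _ : Link => expMeasure 1)
        (i := .interf N) (j := .forward N) (by simp), map_measureReal_apply (by fun_prop) hB]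
      rfl
    rw [hset, gainLaw_real_inter_of_dependsOn
      (S := {l | ∃ i < N, l = .interf i ∨ l = .forward i}) (T := {.interf N, .forward N})
      ?_ (hm N) ?_ ?_ ?_, ih, hpair, pow_succ]
    · simp only [ofPred_forall]
      exact MeasurableSet.iInter fun i => MeasurableSet.iInter fun _ => hm i
    · intro x y hxy
      have : ∀ i < N, x (.interf i) = y (.interf i) ∧ x (.forward i) = y (.forward i) :=
        fun i hi => ⟨hxy _ ⟨i, hi, Or.inl rfl⟩, hxy _ ⟨i, hi, Or.inr rfl⟩⟩
      simp only [mem_ofPred_eq, eq_iff_iff]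
      exact forall₂_congr fun i hi => by rw [(this i hi).1, (this i hi).2]
    · intro x y hxy
      simp [hxy (.interf N) (by simp), hxy (.forward N) (by simp)]
    · rw [Set.disjoint_left]
      rintro _ ⟨i, hi, rfl | rfl⟩ <;> simp [hi.ne]

theorem ae_pos_gainLaw : ∀ᵐ x ∂gainLaw, ∀ l, 0 < x l :=
  ae_all_iff.2 fun l => (measurePreserving_eval_gainLaw l).quasiMeasurePreserving.ae
    ae_pos_expMeasure_one

theorem ae_ne_gainLaw : ∀ᵐ x ∂gainLaw, ∀ l l' : Link, l ≠ l' → x l ≠ x l' := by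
  refine ae_all_iff.2 fun l => ae_all_iff.2 fun l' => ?_
  by_cases hl : l = l'
  · simp [hl]
  have h : ∀ᵐ p ∂(expMeasure 1).prod (expMeasure 1), p.1 ≠ p.2 := by
    refine (Measure.ae_prod_iff_ae_ae (measurableSet_eq_fun measurable_fst measurable_snd).compl).2
      (Eventually.of_forall fun a => ?_)
    have := measure_singleton (μ := expMeasure 1) a
    filter_upwards [compl_mem_ae_iff.2 this] with b hb
    exact fun h => hb h.symm
  rw [← Measure.infinitePi_map_eval_prod (P := fun _ : Link => expMeasure 1) hl] at h
  filter_upwards [ae_of_ae_map (by fun_prop) h] with x hx _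
  exact hx

theorem integrable_comp_eval_gainLaw {φ : ℝ → ℝ} (hφ : Integrable φ (expMeasure 1)) (l : Link) :
    Integrable (fun x => φ (x l)) gainLaw :=
  (measurePreserving_eval_gainLaw l).integrable_comp_of_integrable hφ

/-! ### The best forward gain among the transmitters with small interference gain -/

/-- The event that none of the first `N` interference gains is below `c`. -/
def noCandidate (c : ℝ) (N : ℕ) : Set (Link → ℝ) := {x | ∀ i < N, c ≤ x (.interf i)}

/-- The forward gain of transmitter `i` if its interference gain is below `c`, and `0` otherwise. -/
noncomputable def candGain (c : ℝ) (x : Link → ℝ) (i : ℕ) : ℝ :=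
  if x (.interf i) < c then x (.forward i) else 0

/-- The largest forward gain among those of the first `N` transmitters whose interference gain is
below `c`, and `0` if there is none. -/
noncomputable def bestGain (c : ℝ) (N : ℕ) (x : Link → ℝ) : ℝ :=
  (Finset.range N).fold max 0 (candGain c x)

theorem measurableSet_noCandidate (c : ℝ) (N : ℕ) : MeasurableSet (noCandidate c N) := by
  simp only [noCandidate, ofPred_forall]
  exact MeasurableSet.iInter fun i => MeasurableSet.iInter fun _ =>
    measurableSet_le measurable_const (measurable_pi_apply _)

theorem dependsOn_noCandidate (c : ℝ) (N : ℕ) :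
    DependsOn (· ∈ noCandidate c N) (range Link.interf) := by
  intro x y hxy
  simp only [noCandidate, mem_ofPred_eq, eq_iff_iff]
  exact forall₂_congr fun i _ => by rw [hxy (.interf i) (by simp)]

theorem measurable_candGain (c : ℝ) (i : ℕ) : Measurable fun x => candGain c x i :=
  Measurable.ite (measurableSet_lt (measurable_pi_apply _) measurable_const)
    (measurable_pi_apply _) measurable_const

theorem measurable_fold_max {α : Type*} [MeasurableSpace α] {f : ℕ → α → ℝ}
    (hf : ∀ i, Measurable (f i)) (N : ℕ) :
    Measurable fun x => (Finset.range N).fold max 0 fun i => f i x := by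
  induction N with
  | zero => simp
  | succ N ih =>
    simp only [Finset.range_add_one, Finset.fold_insert Finset.notMem_range_self]
    exact (hf N).max ih

theorem measurable_bestGain (c : ℝ) (N : ℕ) : Measurable (bestGain c N) :=
  measurable_fold_max (measurable_candGain c) N

theorem bestGain_nonneg (c : ℝ) (N : ℕ) (x : Link → ℝ) : 0 ≤ bestGain c N x :=
  (Finset.le_fold_max _).2 (Or.inl le_rfl)

theorem dependsOn_bestGain (c : ℝ) (N : ℕ) : DependsOn (bestGain c N) {.primary}ᶜ := by
  intro x y hxy
  refine Finset.fold_congr fun i _ => ?_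
  simp only [candGain, hxy (.interf i) (by simp), hxy (.forward i) (by simp)]

theorem fold_max_le_sum {f g : ℕ → ℝ} (N : ℕ) (hg : ∀ i, 0 ≤ g i) (hfg : ∀ i, f i ≤ g i) :
    (Finset.range N).fold max 0 f ≤ ∑ i ∈ Finset.range N, g i :=
  (Finset.fold_max_le _).2 ⟨Finset.sum_nonneg fun i _ => hg i, fun i hi =>
    (hfg i).trans (Finset.single_le_sum (f := g) (fun j _ => hg j) hi)⟩

theorem gainLaw_real_noCandidate {c : ℝ} (hc : 0 ≤ c) (N : ℕ) :
    gainLaw.real (noCandidate c N) = Real.exp (-c) ^ N := by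
  have h := gainLaw_real_forall_pair
    ((measurableSet_Ici (a := c)).prod (MeasurableSet.univ (α := ℝ))) N
  rw [measureReal_prod_prod, expMeasure_one_real_Ici hc] at h
  simpa [noCandidate] using h

/-- The best gain stays below y exactly when no transmitter has both interference gain below c and
forward gain at least y. The default value 0 of the maximum does not disturb this since y > 0. -/
theorem gainLaw_real_bestGain_lt {c y : ℝ} (hc : 0 ≤ c) (hy : 0 < y) (N : ℕ) :
    gainLaw.real {x | bestGain c N x < y} = (1 - (1 - Real.exp (-c)) * Real.exp (-y)) ^ N := by
  have h := gainLaw_real_forall_pair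
    ((measurableSet_Iio (a := c)).prod (measurableSet_Ici (a := y))).compl N
  rw [probReal_compl_eq_one_sub (measurableSet_Iio.prod measurableSet_Ici), measureReal_prod_prod,
    expMeasure_one_real_Ici hy.le, expMeasure_one_real_Iio hc] at h
  rw [← h]
  congr 1
  ext x
  simp only [bestGain, mem_ofPred_eq, Finset.fold_max_lt, hy, true_and, Finset.mem_range, mem_compl_iff,
    mem_prod, mem_Iio, mem_Ici, not_and, not_le]
  refine forall₂_congr fun i _ => ?_
  by_cases hi : x (.interf i) < c <;> simp [candGain, hi, hy]

theorem gainLaw_real_bestGain_lt_le {c y : ℝ} (hc : 0 ≤ c) (hy : 0 < y) (N : ℕ) :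
    gainLaw.real {x | bestGain c N x < y} ≤
      Real.exp (-(N * ((1 - Real.exp (-c)) * Real.exp (-y)))) := by
  rw [gainLaw_real_bestGain_lt hc hy, ← mul_neg, Real.exp_nat_mul]
  refine pow_le_pow_left₀ ?_ ?_ N
  · have h1 := Real.exp_nonneg (-c)
    have h2 : Real.exp (-y) ≤ 1 := Real.exp_le_one_iff.2 (by linarith)
    nlinarith [Real.exp_nonneg (-y)]
  · have := Real.add_one_le_exp (-((1 - Real.exp (-c)) * Real.exp (-y)))
    linarith

theorem integrable_sum_forward (N : ℕ) :
    Integrable (fun x : Link → ℝ => ∑ i ∈ Finset.range N, x (.forward i)) gainLaw :=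
  integrable_finsetSum _ fun _ _ => integrable_comp_eval_gainLaw integrable_id_expMeasure_one _

theorem ae_bestGain_le_sum (c : ℝ) (N : ℕ) :
    ∀ᵐ x ∂gainLaw, bestGain c N x ≤ ∑ i ∈ Finset.range N, x (.forward i) := by
  filter_upwards [ae_pos_gainLaw] with x hx
  refine fold_max_le_sum N (fun i => (hx _).le) fun i => ?_
  by_cases hi : x (.interf i) < c <;> simp [candGain, hi, (hx (.forward i)).le]

theorem integrable_bestGain (c : ℝ) (N : ℕ) : Integrable (bestGain c N) gainLaw := by
  refine (integrable_sum_forward N).mono' (measurable_bestGain c N).aestronglyMeasurable ?_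
  filter_upwards [ae_bestGain_le_sum c N] with x hx
  rwa [Real.norm_of_nonneg (bestGain_nonneg c N x)]

/-- Mean excess of the best gain over the level `d`. -/
theorem integral_max_bestGain_sub_le {c d : ℝ} (hc : 0 ≤ c) (hd : 0 ≤ d) (N : ℕ) :
    ∫ x, max (bestGain c N x - d) 0 ∂gainLaw ≤ N * ((1 - Real.exp (-c)) * Real.exp (-d)) := by
  set A : ℕ → Set (Link → ℝ) := fun i => {x | x (.interf i) < c}
  have hA : ∀ i, MeasurableSet (A i) := fun i =>
    measurableSet_lt (measurable_pi_apply _) measurable_const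
  have hint : Integrable (fun y : ℝ => max (y - d) 0) (expMeasure 1) :=
    (integrable_id_expMeasure_one.sub (integrable_const d)).pos_part
  have hterm : ∀ i, Integrable ((A i).indicator fun x => max (x (.forward i) - d) 0) gainLaw :=
    fun i => (integrable_comp_eval_gainLaw hint (.forward i)).indicator (hA i)
  have hA_real : ∀ i, gainLaw.real (A i) = 1 - Real.exp (-c) := fun i => by
    rw [← expMeasure_one_real_Iio hc, ← (measurePreserving_eval_gainLaw (.interf i)).map_eq,
      map_measureReal_apply (measurable_pi_apply _) measurableSet_Iio]
    rfl
  -- The excess of a maximum is at most the sum of the individual excesses. Each term then factors,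
  -- since the two gains of one transmitter are independent.
  calc ∫ x, max (bestGain c N x - d) 0 ∂gainLaw
      ≤ ∫ x, ∑ i ∈ Finset.range N, (A i).indicator (fun x => max (x (.forward i) - d) 0) x
          ∂gainLaw := by
        refine integral_mono_ae ((integrable_bestGain c N).sub (integrable_const d)).pos_part
          (integrable_finsetSum _ fun i _ => hterm i) (Eventually.of_forall fun x => ?_)
        have hnn : ∀ i ∈ Finset.range N,
            0 ≤ (A i).indicator (fun x => max (x (.forward i) - d) 0) x := fun i _ =>
          indicator_nonneg (fun _ _ => le_max_right _ _) x
        refine max_le ?_ (Finset.sum_nonneg hnn)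
        rw [sub_le_iff_le_add]
        refine (Finset.fold_max_le _).2 ⟨add_nonneg (Finset.sum_nonneg hnn) hd, fun i hi => ?_⟩
        refine le_trans ?_ (add_le_add_left (Finset.single_le_sum hnn hi) d)
        by_cases hx : x (.interf i) < c
        · have hxA : x ∈ A i := hx
          simp only [candGain, hx, if_true, indicator_of_mem hxA]
          linarith [le_max_left (x (.forward i) - d) 0]
        · have hxA : x ∉ A i := hx
          simpa [candGain, hx, indicator_of_notMem hxA] using hd
    _ = ∑ i ∈ Finset.range N, Real.exp (-d) * (1 - Real.exp (-c)) := by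
        rw [integral_finsetSum _ fun i _ => hterm i]
        refine Finset.sum_congr rfl fun i _ => ?_
        rw [integral_indicator (hA i), setIntegral_gainLaw_of_dependsOn (φ := fun y => max (y - d) 0)
          (by fun_prop) (hA i) (T := {.interf i}) (fun x y hxy => by simp [A, hxy _ rfl])
          (by simp), integral_max_sub_expMeasure_one hd, hA_real]
    _ = N * ((1 - Real.exp (-c)) * Real.exp (-d)) := by
        rw [Finset.sum_const, Finset.card_range, nsmul_eq_mul]
        ring

theorem integrable_log_one_add_bestGain (c : ℝ) {p : ℝ} (hp : 0 ≤ p) (N : ℕ) :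
    Integrable (fun x => Real.log (1 + p * bestGain c N x)) gainLaw := by
  refine ((integrable_bestGain c N).const_mul p).mono' (Measurable.aestronglyMeasurable
    (by have := measurable_bestGain c N; fun_prop)) (Eventually.of_forall fun x => ?_)
  have h0 := mul_nonneg hp (bestGain_nonneg c N x)
  rw [Real.norm_of_nonneg (Real.log_nonneg (by linarith))]
  exact log_one_add_le_self h0

/-- By concavity, log(1 + px) lies below its tangent at d, whose slope is p/(1 + pd). The choice of
d makes the mean excess of the best gain over d at most 1. -/
theorem integral_log_one_add_bestGain_le {c p d : ℝ} (hc : 0 ≤ c) (hp : 0 ≤ p) (hd : 0 ≤ d)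
    {N : ℕ} (hN : N * (1 - Real.exp (-c)) = Real.exp d) :
    ∫ x, Real.log (1 + p * bestGain c N x) ∂gainLaw ≤
      Real.log (1 + p * d) + p / (1 + p * d) := by
  have hpd : 0 < 1 + p * d := by positivity
  have hint : Integrable (fun x => max (bestGain c N x - d) 0) gainLaw :=
    ((integrable_bestGain c N).sub (integrable_const d)).pos_part
  have hexc : ∫ x, max (bestGain c N x - d) 0 ∂gainLaw ≤ 1 := by
    refine (integral_max_bestGain_sub_le hc hd N).trans_eq ?_
    rw [← mul_assoc, hN, ← Real.exp_add]
    simp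
  calc ∫ x, Real.log (1 + p * bestGain c N x) ∂gainLaw
      ≤ ∫ x, (Real.log (1 + p * d) + p / (1 + p * d) * max (bestGain c N x - d) 0) ∂gainLaw := by
        refine integral_mono (integrable_log_one_add_bestGain c hp N)
          ((integrable_const _).add (hint.const_mul _)) fun x => ?_
        have hx := bestGain_nonneg c N x
        have hpos : 0 < 1 + p * bestGain c N x := by positivity
        have h := Real.log_le_sub_one_of_pos (div_pos hpos hpd)
        rw [Real.log_div hpos.ne' hpd.ne'] at h
        have h2 : (1 + p * bestGain c N x) / (1 + p * d) - 1 =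
            p / (1 + p * d) * (bestGain c N x - d) := by
          field_simp
          ring
        have h3 : p / (1 + p * d) * (bestGain c N x - d) ≤
            p / (1 + p * d) * max (bestGain c N x - d) 0 := by
          gcongr
          exact le_max_left _ _
        dsimp only
        linarith
    _ = Real.log (1 + p * d) + p / (1 + p * d) * ∫ x, max (bestGain c N x - d) 0 ∂gainLaw := by
        rw [integral_add (integrable_const _) (hint.const_mul _), integral_const_mul]
        simp
    _ ≤ _ := by
        gcongr
        exact mul_le_of_le_one_right (by positivity) hexc

/-- Lowering the level from d to d - ln d raises the expected number of candidates above it from 1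
to d. This makes a shortfall exponentially unlikely at a negligible cost in the level. -/
theorem gainLaw_real_bestGain_lt_sub_log {c d : ℝ} (hc : 0 ≤ c) (hd : 0 < d)
    {N : ℕ} (hN : N * (1 - Real.exp (-c)) = Real.exp d) :
    gainLaw.real {x | bestGain c N x < d - Real.log d} ≤ Real.exp (-d) := by
  have hy : 0 < d - Real.log d := by linarith [Real.log_le_sub_one_of_pos hd]
  refine (gainLaw_real_bestGain_lt_le hc hy N).trans_eq ?_
  rw [← mul_assoc, hN, ← Real.exp_add]
  congr 2
  rw [show d + -(d - Real.log d) = Real.log d by ring, Real.exp_log hd]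

/-- The integrand is nonnegative, so only the event that the best gain reaches d - ln d is kept. -/
theorem le_integral_log_one_add_bestGain {c p d : ℝ} (hc : 0 ≤ c) (hp : 0 ≤ p) (hd : 0 < d)
    {N : ℕ} (hN : N * (1 - Real.exp (-c)) = Real.exp d) :
    Real.log (1 + p * (d - Real.log d)) * (1 - Real.exp (-d)) ≤
      ∫ x, Real.log (1 + p * bestGain c N x) ∂gainLaw := by
  set y := d - Real.log d
  have hy : 0 < y := by linarith [Real.log_le_sub_one_of_pos hd]
  set B : Set (Link → ℝ) := {x | bestGain c N x < y}
  have hB : MeasurableSet B := measurableSet_lt (measurable_bestGain c N) measurable_const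
  have hlog : 0 ≤ Real.log (1 + p * y) := Real.log_nonneg (by nlinarith)
  calc Real.log (1 + p * y) * (1 - Real.exp (-d))
      ≤ Real.log (1 + p * y) * gainLaw.real Bᶜ := by
        gcongr
        rw [probReal_compl_eq_one_sub hB]
        linarith [gainLaw_real_bestGain_lt_sub_log hc hd hN]
    _ = ∫ x, Bᶜ.indicator (fun _ => Real.log (1 + p * y)) x ∂gainLaw := by
        rw [integral_indicator hB.compl, setIntegral_const, smul_eq_mul, mul_comm]
    _ ≤ _ := by
        refine integral_mono ((integrable_const _).indicator hB.compl)
          (integrable_log_one_add_bestGain c hp N) fun x => ?_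
        by_cases hxB : x ∈ B
        · rw [indicator_of_notMem (by simpa using hxB)]
          exact Real.log_nonneg (by nlinarith [bestGain_nonneg c N x])
        · rw [indicator_of_mem hxB]
          have hx : y ≤ bestGain c N x := not_lt.1 hxB
          exact Real.log_le_log (by positivity) (by gcongr)

/-- The interference of the primary transmitter costs a constant up to a vanishing term. -/
theorem abs_integral_log_one_add_bestGain_div_sub_le {c p q d : ℝ} (hc : 0 ≤ c) (hp : 0 ≤ p)
    (hq : 0 < q) (hd : 0 < d) {N : ℕ} (hN : N * (1 - Real.exp (-c)) = Real.exp d) :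
    |∫ x, Real.log (1 + p * bestGain c N x / (1 + x .primary * q)) ∂gainLaw -
        (∫ x, Real.log (1 + p * bestGain c N x) ∂gainLaw -
          Real.exp (1 / q) * expIntegralE1 (1 / q))| ≤
      q * (1 / (1 + p * (d - Real.log d)) + Real.exp (-d)) := by
  set y := d - Real.log d
  have hy : 0 < y := by linarith [Real.log_le_sub_one_of_pos hd]
  set B : Set (Link → ℝ) := {x | bestGain c N x < y}
  have hMm := measurable_bestGain c N
  have hB : MeasurableSet B := measurableSet_lt hMm measurable_const
  have hI0 := integrable_log_one_add_bestGain c hp N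
  have hI1 : Integrable (fun x : Link → ℝ => Real.log (1 + x .primary * q)) gainLaw :=
    integrable_comp_eval_gainLaw (φ := fun y => Real.log (1 + y * q))
      (integrable_log_one_add_mul_expMeasure_one hq) .primary
  have hE1 : ∫ x : Link → ℝ, Real.log (1 + x .primary * q) ∂gainLaw =
      Real.exp (1 / q) * expIntegralE1 (1 / q) := by
    rw [← integral_log_one_add_mul_expMeasure_one hq]
    exact integral_comp_eval_gainLaw (φ := fun y => Real.log (1 + y * q)) (by fun_prop) .primary
  have hZ : Integrable (fun x : Link → ℝ => x .primary) gainLaw :=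
    integrable_comp_eval_gainLaw integrable_id_expMeasure_one .primary
  have hI2 : Integrable
      (fun x => Real.log (1 + p * bestGain c N x / (1 + x .primary * q))) gainLaw := by
    refine hI0.mono' (Measurable.aestronglyMeasurable (by fun_prop)) ?_
    filter_upwards [ae_pos_gainLaw] with x hx
    have h0 := bestGain_nonneg c N x
    have hz := hx .primary
    have h1 : 0 ≤ p * bestGain c N x := by positivity
    have h2 : p * bestGain c N x / (1 + x .primary * q) ≤ p * bestGain c N x :=
      div_le_self h1 (by nlinarith)
    have h3 : 0 ≤ p * bestGain c N x / (1 + x .primary * q) := by positivity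
    rw [Real.norm_of_nonneg (Real.log_nonneg (by linarith))]
    exact Real.log_le_log (by linarith) (by linarith)
  have hI3 : Integrable (fun x => Real.log (1 + p * bestGain c N x) -
      Real.log (1 + x .primary * q)) gainLaw := hI0.sub hI1
  rw [← hE1, ← integral_sub hI0 hI1, ← integral_sub hI2 hI3]
  have hbound : Integrable (fun x : Link → ℝ =>
      q * (x .primary / (1 + p * y) + B.indicator (fun x => x .primary) x)) gainLaw :=
    ((hZ.div_const _).add (hZ.indicator hB)).const_mul q
  calc _ ≤ ∫ x : Link → ℝ,
        q * (x .primary / (1 + p * y) + B.indicator (fun x => x .primary) x) ∂gainLaw := by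
        rw [← Real.norm_eq_abs]
        refine norm_integral_le_of_norm_le hbound ?_
        filter_upwards [ae_pos_gainLaw] with x hx
        have h0 := bestGain_nonneg c N x
        have hz := hx .primary
        have h1 : 0 < 1 + p * bestGain c N x := by positivity
        have h2 : 0 < 1 + x .primary * q := by positivity
        have h3 : 0 ≤ x .primary * q / (1 + p * bestGain c N x) := by positivity
        -- The three logarithms combine exactly, because multiplying 1 + pM/(1 + qZ) by 1 + qZ gives
        -- 1 + qZ + pM.
        have hrw : Real.log (1 + p * bestGain c N x / (1 + x .primary * q)) -
            (Real.log (1 + p * bestGain c N x) - Real.log (1 + x .primary * q)) =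
            Real.log (1 + x .primary * q / (1 + p * bestGain c N x)) := by
          have e1 : 1 + p * bestGain c N x / (1 + x .primary * q) =
              (1 + x .primary * q + p * bestGain c N x) / (1 + x .primary * q) := by
            field_simp
          have e2 : 1 + x .primary * q / (1 + p * bestGain c N x) =
              (1 + x .primary * q + p * bestGain c N x) / (1 + p * bestGain c N x) := by
            field_simp
            ring
          have h4 : 0 < 1 + x .primary * q + p * bestGain c N x := by positivity
          rw [e1, e2, Real.log_div h4.ne' h2.ne', Real.log_div h4.ne' h1.ne']
          ring
        rw [hrw, Real.norm_of_nonneg (Real.log_nonneg (by linarith))]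
        refine (log_one_add_le_self h3).trans ?_
        rw [mul_comm (x .primary) q, mul_div_assoc]
        gcongr
        -- On the rare event B the denominator is bounded below by 1 only. Off B the best gain is at
        -- least y, which supplies the small factor.
        by_cases hxB : x ∈ B
        · rw [indicator_of_mem hxB]
          have := div_le_self hz.le (by nlinarith : 1 ≤ 1 + p * bestGain c N x)
          have : 0 ≤ x .primary / (1 + p * y) := by positivity
          linarith
        · rw [indicator_of_notMem hxB, add_zero]
          have hx' : y ≤ bestGain c N x := not_lt.1 hxB
          gcongr
    _ = q * (1 / (1 + p * y) + gainLaw.real B) := by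
        have hEZ : ∫ x : Link → ℝ, x .primary ∂gainLaw = 1 := by
          rw [← integral_id_expMeasure_one]
          exact integral_comp_eval_gainLaw measurable_id .primary
        -- The event B does not involve the primary link, so the mean of Z over B is the probability
        -- of B.
        have hdep : DependsOn (· ∈ B) {Link.primary}ᶜ := fun x y hxy => by
          simp only [B, mem_ofPred_eq, dependsOn_bestGain c N hxy]
        rw [integral_const_mul, integral_add (hZ.div_const _) (hZ.indicator hB),
          integral_div, hEZ, integral_indicator hB,
          setIntegral_gainLaw_of_dependsOn (φ := fun y => y) measurable_id hB hdep (by simp)]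
        simp [integral_id_expMeasure_one]
    _ ≤ _ := by
        gcongr
        exact gainLaw_real_bestGain_lt_sub_log hc hd hN

/-! ### The transmitter with the best forward gain -/

/-- The event that transmitter `i` has a forward gain above that of each other transmitter among
the first `N` whose interference gain is below `c`. -/
def beatsRivals (c : ℝ) (N i : ℕ) : Set (Link → ℝ) :=
  {x | ∀ j < N, j ≠ i → x (.interf j) < c → x (.forward j) < x (.forward i)}

/-- The event that transmitter `i` has an interference gain below `c` and is the best of these. -/
def isBest (c : ℝ) (N i : ℕ) : Set (Link → ℝ) := {x | x (.interf i) < c} ∩ beatsRivals c N i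

theorem measurableSet_beatsRivals (c : ℝ) (N i : ℕ) : MeasurableSet (beatsRivals c N i) := by
  have h : ∀ j, MeasurableSet
      {x : Link → ℝ | x (.interf j) < c → x (.forward j) < x (.forward i)} := fun j =>
    (measurableSet_lt (measurable_pi_apply _) measurable_const).imp
      (measurableSet_lt (measurable_pi_apply _) (measurable_pi_apply _))
  simp only [beatsRivals, ofPred_forall] at h ⊢
  exact MeasurableSet.iInter fun j => MeasurableSet.iInter fun _ => MeasurableSet.iInter fun _ =>
    h j

theorem measurableSet_isBest (c : ℝ) (N i : ℕ) : MeasurableSet (isBest c N i) :=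
  (measurableSet_lt (measurable_pi_apply _) measurable_const).inter (measurableSet_beatsRivals c N i)

/-- This is why the rivals exclude i itself and why the candidacy of i is kept apart in `isBest`:
given candidacy, winning carries no information about the winner's interference gain. -/
theorem dependsOn_beatsRivals (c : ℝ) (N i : ℕ) :
    DependsOn (· ∈ beatsRivals c N i) {.interf i}ᶜ := by
  intro x y hxy
  simp only [beatsRivals, mem_ofPred_eq, eq_iff_iff]
  refine forall₃_congr fun j _ hj => ?_
  rw [hxy (.interf j) (by simpa using hj), hxy (.forward j) (by simp),
    hxy (.forward i) (by simp)]

theorem isBest_unique {c : ℝ} {N i j : ℕ} (hi : i < N) (hj : j < N) {x : Link → ℝ}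
    (hxi : x ∈ isBest c N i) (hxj : x ∈ isBest c N j) : i = j := by
  by_contra h
  exact lt_asymm (hxi.2 j hj (Ne.symm h) hxj.1) (hxj.2 i hi h hxi.1)

theorem isBest_subset_compl_noCandidate {c : ℝ} {N i : ℕ} (hi : i < N) :
    isBest c N i ⊆ (noCandidate c N)ᶜ := fun _ hx hx' => not_le.2 hx.1 (hx' i hi)

/-- A largest forward gain exists as soon as there is a candidate, and it is strictly largest
because ties have probability zero. -/
theorem biUnion_isBest_ae_eq (c : ℝ) (N : ℕ) :
    (⋃ i ∈ Finset.range N, isBest c N i : Set (Link → ℝ)) =ᵐ[gainLaw]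
      ((noCandidate c N)ᶜ : Set (Link → ℝ)) := by
  refine Filter.eventuallyEq_set.2 ?_
  filter_upwards [ae_ne_gainLaw] with x hx
  simp only [mem_iUnion, Finset.mem_range, exists_prop]
  refine ⟨fun ⟨i, hi, hxi⟩ => isBest_subset_compl_noCandidate hi hxi, fun hxc => ?_⟩
  have hne : ((Finset.range N).filter fun i => x (.interf i) < c).Nonempty := by
    simp only [noCandidate, mem_compl_iff, mem_ofPred_eq, not_forall, not_le] at hxc
    obtain ⟨i, hi, hxi⟩ := hxc
    exact ⟨i, by simp [hi, hxi]⟩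
  obtain ⟨i, hi, hmax⟩ := Finset.exists_max_image _ (fun i => x (.forward i)) hne
  simp only [Finset.mem_filter, Finset.mem_range] at hi hmax
  exact ⟨i, hi.1, hi.2, fun j hj hji hxj =>
    lt_of_le_of_ne (hmax j ⟨hj, hxj⟩) (hx _ _ (by simpa using hji))⟩

theorem sum_gainLaw_real_isBest (c : ℝ) (N : ℕ) :
    ∑ i ∈ Finset.range N, gainLaw.real (isBest c N i) = gainLaw.real (noCandidate c N)ᶜ := by
  rw [← measureReal_congr (biUnion_isBest_ae_eq c N), measureReal_biUnion_finset]
  · intro i hi j hj hij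
    refine Set.disjoint_left.2 fun x hxi hxj => hij ?_
    exact isBest_unique (Finset.mem_range.1 hi) (Finset.mem_range.1 hj) hxi hxj
  · exact fun i _ => measurableSet_isBest c N i

/-- The interference gain of the best candidate has the exponential law conditioned to be
below `c`. -/
theorem sum_setIntegral_isBest {c : ℝ} (hc : 0 < c) (N : ℕ) {φ : ℝ → ℝ} (hφ : Measurable φ) :
    ∑ i ∈ Finset.range N, ∫ x in isBest c N i, φ (x (.interf i)) ∂gainLaw =
      (∫ y, (Iio c).indicator φ y ∂expMeasure 1) / (1 - Real.exp (-c)) *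
        gainLaw.real (noCandidate c N)ᶜ := by
  have key : ∀ (i : ℕ) {ψ : ℝ → ℝ} (_ : Measurable ψ),
      ∫ x in isBest c N i, ψ (x (.interf i)) ∂gainLaw =
        (∫ y, (Iio c).indicator ψ y ∂expMeasure 1) * gainLaw.real (beatsRivals c N i) := by
    intro i ψ hψ
    rw [← setIntegral_gainLaw_of_dependsOn (l := .interf i) (hψ.indicator measurableSet_Iio)
      (measurableSet_beatsRivals c N i) (dependsOn_beatsRivals c N i) (by simp), isBest, inter_comm,
      ← setIntegral_indicator (measurableSet_lt (measurable_pi_apply _) measurable_const)]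
    rfl
  have hq : 1 - Real.exp (-c) ≠ 0 := by
    have : Real.exp (-c) < 1 := by simpa using hc
    linarith
  rw [← sum_gainLaw_real_isBest, Finset.mul_sum]
  refine Finset.sum_congr rfl fun i _ => ?_
  -- The constant function 1 evaluates the probability of `isBest`, which eliminates the unknown
  -- probability of `beatsRivals`.
  have h1 := key i (ψ := fun _ => 1) measurable_const
  rw [setIntegral_const, integral_indicator_const _ measurableSet_Iio,
    expMeasure_one_real_Iio hc.le] at h1
  simp only [smul_eq_mul, mul_one] at h1
  rw [key i hφ, h1]
  field_simp

namespace Params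

variable {s : Params}

/-! ### Power control and departure rate -/

theorem Rp_pos (hPp : 0 < s.Pp) (hR : 0 < s.R) : 0 < s.Rp :=
  div_pos (sub_pos.2 (Real.one_lt_rpow one_lt_two hR)) hPp

theorem outage_eq (hPp : 0 < s.Pp) (hR : 0 < s.R) {I : ℝ} (hI : 0 ≤ I) :
    s.outage I = 1 - Real.exp (-(s.Rp * (1 + I))) := by
  have hRp := Rp_pos hPp hR
  rw [← expMeasure_one_real_Iio (by positivity : 0 ≤ s.Rp * (1 + I)), outage]
  refine measureReal_congr (Filter.eventuallyEq_set.2 ?_)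
  filter_upwards [ae_pos_expMeasure_one] with x hx
  have hI1 : 0 < 1 + I := by linarith
  have h1 : 0 < 1 + x * s.Pp / (1 + I) := by positivity
  rw [mem_Iio, Real.logb_lt_iff_lt_rpow one_lt_two h1, Rp, div_mul_eq_mul_div,
    lt_div_iff₀ hPp, ← lt_sub_iff_add_lt', div_lt_iff₀ hI1]

/-- Departure rate of the primary transmitter under received interference power `I`. -/
theorem departureRate_eq (hPp : 0 < s.Pp) (hR : 0 < s.R) {a p : ℝ} (h : 0 ≤ a * p) :
    s.departureRate a p =
      s.pd * Real.exp (-s.Rp) + (1 - s.pd) * Real.exp (-(s.Rp * (1 + a * p))) := by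
  rw [departureRate, outage_eq hPp hR le_rfl, outage_eq hPp hR h]
  simp

/-- Interference gain below which a secondary transmitter saturates at its maximum power. -/
noncomputable def gainThreshold (s : Params) : ℝ := s.K / s.Psmax

theorem gainThreshold_pos (hPs : 0 < s.Psmax) (hK : 0 < s.K) : 0 < s.gainThreshold :=
  div_pos hK hPs

theorem Psmax_lt_Pmu_iff (hPs : 0 < s.Psmax) {a : ℝ} (ha : 0 < a) :
    s.Psmax < s.Pmu a ↔ a < s.gainThreshold := by
  rw [Pmu, gainThreshold, lt_div_iff₀ hPs, one_div_mul_eq_div, lt_div_iff₀ ha, mul_comm]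

theorem txPower_of_lt (hPs : 0 < s.Psmax) {a : ℝ} (ha : 0 < a) (h : a < s.gainThreshold) :
    s.txPower a = s.Psmax := by
  have := (Psmax_lt_Pmu_iff hPs ha).2 h
  rw [txPower, if_neg (by linarith), if_neg (by linarith)]

theorem txPower_of_le (hPs : 0 < s.Psmax) (hK : 0 < s.K) {a : ℝ} (ha : 0 < a)
    (h : s.gainThreshold ≤ a) : s.txPower a = s.Pmu a := by
  have h1 : s.Pmu a ≤ s.Psmax := not_lt.1 fun h' => not_lt.2 h ((Psmax_lt_Pmu_iff hPs ha).1 h')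
  have h2 : 0 < s.Pmu a := mul_pos (one_div_pos.2 ha) hK
  rw [txPower, if_neg h2.not_gt]
  split_ifs with h3
  · rfl
  · exact le_antisymm (not_lt.1 h3) h1

theorem txPower_nonneg (hPs : 0 < s.Psmax) (a : ℝ) : 0 ≤ s.txPower a := by
  rw [txPower]
  split_ifs <;> linarith

theorem txPower_le (hPs : 0 < s.Psmax) (a : ℝ) : s.txPower a ≤ s.Psmax := by
  rw [txPower]
  split_ifs <;> linarith

theorem measurable_txPower : Measurable s.txPower := by
  have h : Measurable s.Pmu := by
    unfold Pmu
    fun_prop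
  exact Measurable.ite (measurableSet_lt h measurable_const) measurable_const
    (Measurable.ite (measurableSet_lt h measurable_const) h measurable_const)

/-- Departure rate when a transmitter with interference gain `a` uses the maximum power. -/
noncomputable def saturatedDeparture (s : Params) (a : ℝ) : ℝ :=
  s.pd * Real.exp (-s.Rp) + (1 - s.pd) * Real.exp (-(s.Rp * (1 + a * s.Psmax)))

theorem measurable_saturatedDeparture : Measurable s.saturatedDeparture := by
  unfold saturatedDeparture
  fun_prop

theorem departureRate_of_lt (hPp : 0 < s.Pp) (hR : 0 < s.R) (hPs : 0 < s.Psmax) {a : ℝ}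
    (ha : 0 < a) (h : a < s.gainThreshold) :
    s.departureRate a (s.txPower a) = s.saturatedDeparture a := by
  rw [txPower_of_lt hPs ha h, departureRate_eq hPp hR (by positivity), saturatedDeparture]

/-- Power control makes the received interference a · P_μ(a) equal to K, and K is by definition the
interference level at which the departure rate is μ_min. -/
theorem departureRate_of_le (hPp : 0 < s.Pp) (hR : 0 < s.R) (hPs : 0 < s.Psmax)
    (hpd1 : s.pd < 1) (hmu : s.pd * Real.exp (-s.Rp) < s.muMin) (hK : 0 < s.K) {a : ℝ}
    (ha : 0 < a) (h : s.gainThreshold ≤ a) :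
    s.departureRate a (s.txPower a) = s.muMin := by
  have hRp := Rp_pos hPp hR
  have haK : a * s.Pmu a = s.K := by
    rw [Pmu]
    field_simp
  rw [txPower_of_le hPs hK ha h, departureRate_eq hPp hR (by rw [haK]; exact hK.le), haK]
  have h1 : 0 < 1 - s.pd := by linarith
  have h2 : 0 < s.muMin - s.pd * Real.exp (-s.Rp) := by linarith
  have h3 : s.Rp * (1 + s.K) = Real.log ((1 - s.pd) / (s.muMin - s.pd * Real.exp (-s.Rp))) := by
    rw [K]
    field_simp
    ring
  rw [h3, ← Real.log_inv, Real.exp_log (inv_pos.2 (div_pos h1 h2)), inv_div,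
    mul_div_cancel₀ _ h1.ne']
  ring

theorem snr_nonneg (hPs : 0 < s.Psmax) (a : ℝ) {b : ℝ} (hb : 0 < b) : 0 ≤ s.snr a b :=
  mul_nonneg (txPower_nonneg hPs a) hb.le

theorem snr_le (hPs : 0 < s.Psmax) (a : ℝ) {b : ℝ} (hb : 0 < b) : s.snr a b ≤ s.Psmax * b :=
  mul_le_mul_of_nonneg_right (txPower_le hPs a) hb.le

theorem rateIdle_mono {a b a' b' : ℝ} (h0 : 0 ≤ s.snr a b)
    (h : s.snr a b ≤ s.snr a' b') : s.rateIdle a b ≤ s.rateIdle a' b' :=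
  Real.logb_le_logb_of_le one_lt_two (by linarith) (by linarith)

theorem rateBusy_mono {a b a' b' bp : ℝ} (hbp : 0 < 1 + bp * s.Pp) (h0 : 0 ≤ s.snr a b)
    (h : s.snr a b ≤ s.snr a' b') : s.rateBusy a b bp ≤ s.rateBusy a' b' bp :=
  Real.logb_le_logb_of_le one_lt_two (by positivity) (by gcongr)

/-! ### The two-stage scheduler as a function of the gains -/

/-- SNR of the transmitter that the two-stage scheduler selects. -/
noncomputable def selectedSNR (s : Params) (N : ℕ) (x : Link → ℝ) : ℝ :=
  s.Psmax * bestGain s.gainThreshold N x + (noCandidate s.gainThreshold N).indicator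
    (fun x => (Finset.range N).fold max 0 fun i => s.snr (x (.interf i)) (x (.forward i))) x

/-- Departure rate under the transmitter that the two-stage scheduler selects. -/
noncomputable def selectedDeparture (s : Params) (N : ℕ) (x : Link → ℝ) : ℝ :=
  (noCandidate s.gainThreshold N).indicator (fun _ => s.muMin) x +
    ∑ i ∈ Finset.range N, (isBest s.gainThreshold N i).indicator
      (fun x => s.saturatedDeparture (x (.interf i))) x

theorem mem_noCandidate_iff (hPs : 0 < s.Psmax) {x : Link → ℝ} (hx : ∀ l, 0 < x l) (N : ℕ) :
    x ∈ noCandidate s.gainThreshold N ↔ s.candidates N (fun i => x (.interf i)) = ∅ := by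
  simp only [candidates, Finset.filter_eq_empty_iff, Finset.mem_range,
    Psmax_lt_Pmu_iff hPs (hx _), not_lt]
  rfl

theorem bestGain_eq_zero {c : ℝ} {N : ℕ} {x : Link → ℝ} (hx : x ∈ noCandidate c N) :
    bestGain c N x = 0 := by
  refine le_antisymm ((Finset.fold_max_le _).2 ⟨le_rfl, fun i hi => ?_⟩) (bestGain_nonneg c N x)
  simp [candGain, not_lt.2 (hx i (Finset.mem_range.1 hi))]

theorem mem_range_of_isTwoStageChoice {N : ℕ} {a b : ℕ → ℝ} {i : ℕ}
    (h : s.IsTwoStageChoice N a b i) : i ∈ Finset.range N := by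
  rcases (s.candidates N a).eq_empty_or_nonempty with h0 | h0
  · exact (h.2 h0).1
  · exact (Finset.mem_filter.1 (h.1 h0).1).1

/-- Both stages maximize a quantity whose maximum does not depend on the tie-breaking, so any
admissible choice gives the same SNR. Starting the maxima at 0 is harmless for positive gains. -/
theorem snr_eq_selectedSNR (hPs : 0 < s.Psmax) {x : Link → ℝ} (hx : ∀ l, 0 < x l) {N i : ℕ}
    (h : s.IsTwoStageChoice N (fun i => x (.interf i)) (fun i => x (.forward i)) i) :
    s.snr (x (.interf i)) (x (.forward i)) = s.selectedSNR N x := by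
  by_cases hc : x ∈ noCandidate s.gainThreshold N
  · obtain ⟨hi, hmax⟩ := h.2 ((mem_noCandidate_iff hPs hx N).1 hc)
    rw [selectedSNR, bestGain_eq_zero hc, indicator_of_mem hc, mul_zero, zero_add]
    exact le_antisymm ((Finset.le_fold_max _).2 (Or.inr ⟨i, hi, le_rfl⟩))
      ((Finset.fold_max_le _).2 ⟨snr_nonneg hPs _ (hx _), hmax⟩)
  · obtain ⟨hi, hmax⟩ := h.1 (Finset.nonempty_iff_ne_empty.2
      fun h0 => hc ((mem_noCandidate_iff hPs hx N).2 h0))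
    simp only [candidates, Finset.mem_filter, Psmax_lt_Pmu_iff hPs (hx _)] at hi hmax
    rw [selectedSNR, indicator_of_notMem hc, add_zero, snr, txPower_of_lt hPs (hx _) hi.2]
    congr 1
    refine le_antisymm ((Finset.le_fold_max _).2 (Or.inr ⟨i, hi.1, by simp [candGain, hi.2]⟩))
      ((Finset.fold_max_le _).2 ⟨(hx _).le, fun j hj => ?_⟩)
    by_cases hj' : x (.interf j) < s.gainThreshold
    · simpa [candGain, hj'] using hmax j ⟨hj, hj'⟩
    · simpa [candGain, hj'] using (hx _).le

/-- Unlike the SNR, the departure rate depends on which candidate wins, hence the requirement that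
distinct links have distinct gains. -/
theorem departureRate_eq_selectedDeparture (hPp : 0 < s.Pp) (hR : 0 < s.R) (hPs : 0 < s.Psmax)
    (hpd1 : s.pd < 1) (hmu : s.pd * Real.exp (-s.Rp) < s.muMin) (hK : 0 < s.K)
    {x : Link → ℝ} (hx : ∀ l, 0 < x l) (hne : ∀ l l' : Link, l ≠ l' → x l ≠ x l') {N i : ℕ}
    (h : s.IsTwoStageChoice N (fun i => x (.interf i)) (fun i => x (.forward i)) i) :
    s.departureRate (x (.interf i)) (s.txPower (x (.interf i))) = s.selectedDeparture N x := by
  by_cases hc : x ∈ noCandidate s.gainThreshold N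
  · have hi := (h.2 ((mem_noCandidate_iff hPs hx N).1 hc)).1
    rw [selectedDeparture, indicator_of_mem hc, Finset.sum_eq_zero, add_zero,
      departureRate_of_le hPp hR hPs hpd1 hmu hK (hx _) (hc i (Finset.mem_range.1 hi))]
    exact fun j hj => indicator_of_notMem
      (fun hj' => isBest_subset_compl_noCandidate (Finset.mem_range.1 hj) hj' hc) _
  · obtain ⟨hi, hmax⟩ := h.1 (Finset.nonempty_iff_ne_empty.2
      fun h0 => hc ((mem_noCandidate_iff hPs hx N).2 h0))
    simp only [candidates, Finset.mem_filter, Psmax_lt_Pmu_iff hPs (hx _)] at hi hmax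
    have hbest : x ∈ isBest s.gainThreshold N i := ⟨hi.2, fun j hj hji hj' =>
      lt_of_le_of_ne (hmax j ⟨Finset.mem_range.2 hj, hj'⟩) (hne _ _ (by simpa using hji))⟩
    rw [selectedDeparture, indicator_of_notMem hc, zero_add, Finset.sum_eq_single_of_mem i hi.1,
      indicator_of_mem hbest, departureRate_of_lt hPp hR hPs (hx _) hi.2]
    exact fun j hj hji => indicator_of_notMem (fun hj' => hji
      (isBest_unique (Finset.mem_range.1 hj) (Finset.mem_range.1 hi.1) hj' hbest)) _

/-! ### Averages over the joint law of the gains -/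

theorem measurable_selectedSNR (N : ℕ) : Measurable (s.selectedSNR N) := by
  refine ((measurable_bestGain _ N).const_mul _).add
    ((measurable_fold_max (fun i => ?_) N).indicator (measurableSet_noCandidate _ N))
  exact (measurable_txPower.comp (measurable_pi_apply _)).mul (measurable_pi_apply _)

theorem selectedSNR_of_notMem {N : ℕ} {x : Link → ℝ} (hx : x ∉ noCandidate s.gainThreshold N) :
    s.selectedSNR N x = s.Psmax * bestGain s.gainThreshold N x := by
  rw [selectedSNR, indicator_of_notMem hx, add_zero]

theorem selectedSNR_nonneg (hPs : 0 < s.Psmax) (N : ℕ) (x : Link → ℝ) :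
    0 ≤ s.selectedSNR N x :=
  add_nonneg (mul_nonneg hPs.le (bestGain_nonneg _ N x))
    (indicator_nonneg (fun _ _ => (Finset.le_fold_max _).2 (Or.inl le_rfl)) x)

theorem ae_selectedSNR_le (hPs : 0 < s.Psmax) (N : ℕ) : ∀ᵐ x ∂gainLaw,
    s.selectedSNR N x ≤ s.Psmax * ∑ i ∈ Finset.range N, x (.forward i) := by
  filter_upwards [ae_pos_gainLaw, ae_bestGain_le_sum s.gainThreshold N] with x hx hle
  by_cases hc : x ∈ noCandidate s.gainThreshold N
  · rw [selectedSNR, bestGain_eq_zero hc, indicator_of_mem hc, mul_zero, zero_add, Finset.mul_sum]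
    exact fold_max_le_sum N (fun i => mul_nonneg hPs.le (hx _).le) fun i => snr_le hPs _ (hx _)
  · rw [selectedSNR_of_notMem hc]
    gcongr

theorem measurable_selectedDeparture (N : ℕ) : Measurable (s.selectedDeparture N) :=
  (measurable_const.indicator (measurableSet_noCandidate _ N)).add
    (Finset.measurable_fun_sum _ fun i _ =>
      (measurable_saturatedDeparture.comp (measurable_pi_apply _)).indicator
        (measurableSet_isBest _ N i))

theorem integrable_saturatedDeparture (hPp : 0 < s.Pp) (hR : 0 < s.R) (hPs : 0 < s.Psmax) :
    Integrable s.saturatedDeparture (expMeasure 1) := by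
  have hRp := Rp_pos hPp hR
  refine (integrable_const (|s.pd * Real.exp (-s.Rp)| + |1 - s.pd|)).mono'
    measurable_saturatedDeparture.aestronglyMeasurable ?_
  filter_upwards [ae_pos_expMeasure_one] with a ha
  rw [Real.norm_eq_abs, saturatedDeparture]
  refine (abs_add_le _ _).trans (add_le_add_right ?_ _)
  rw [abs_mul, Real.abs_exp]
  exact mul_le_of_le_one_right (abs_nonneg _) (Real.exp_le_one_iff.2 (by
    have : 0 ≤ s.Rp * (1 + a * s.Psmax) := by positivity
    linarith))

theorem integrable_selectedDeparture (hPp : 0 < s.Pp) (hR : 0 < s.R) (hPs : 0 < s.Psmax)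
    (N : ℕ) : Integrable (s.selectedDeparture N) gainLaw :=
  ((integrable_const _).indicator (measurableSet_noCandidate _ N)).add
    (integrable_finsetSum _ fun i _ => (integrable_comp_eval_gainLaw
      (integrable_saturatedDeparture hPp hR hPs) (.interf i)).indicator (measurableSet_isBest _ N i))

theorem setIntegral_selectedDeparture_noCandidate (N : ℕ) :
    ∫ x in noCandidate s.gainThreshold N, s.selectedDeparture N x ∂gainLaw =
      s.muMin * gainLaw.real (noCandidate s.gainThreshold N) := by
  rw [setIntegral_congr_fun (g := fun _ => s.muMin) (measurableSet_noCandidate _ N),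
    setIntegral_const, smul_eq_mul, mul_comm]
  intro x hx
  simp only [selectedDeparture]
  rw [indicator_of_mem hx, Finset.sum_eq_zero, add_zero]
  exact fun j hj => indicator_of_notMem
    (fun hj' => isBest_subset_compl_noCandidate (Finset.mem_range.1 hj) hj' hx) _

theorem integral_indicator_saturatedDeparture (hPp : 0 < s.Pp) (hR : 0 < s.R)
    (hPs : 0 < s.Psmax) (hK : 0 < s.K) :
    (∫ a, (Iio s.gainThreshold).indicator s.saturatedDeparture a ∂expMeasure 1) /
      (1 - Real.exp (-s.gainThreshold)) = s.Mavg := by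
  have hRp := Rp_pos hPp hR
  have hc := gainThreshold_pos hPs hK
  have hr : 0 < s.Rp * s.Psmax := by positivity
  have hq : 0 < 1 - Real.exp (-s.gainThreshold) := by
    have : Real.exp (-s.gainThreshold) < 1 := by simpa using hc
    linarith
  have hsplit : ∀ a, (Iio s.gainThreshold).indicator s.saturatedDeparture a =
      (Iio s.gainThreshold).indicator (fun _ => s.pd * Real.exp (-s.Rp)) a +
      (1 - s.pd) * Real.exp (-s.Rp) *
        (Iio s.gainThreshold).indicator (fun a => Real.exp (-(s.Rp * s.Psmax * a))) a := by
    intro a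
    by_cases ha : a < s.gainThreshold
    · simp only [mem_Iio, ha, indicator_of_mem, saturatedDeparture]
      rw [mul_assoc (1 - s.pd), ← Real.exp_add]
      congr 3
      ring
    · simp [ha]
  have hint : Integrable ((Iio s.gainThreshold).indicator
      fun a => Real.exp (-(s.Rp * s.Psmax * a))) (expMeasure 1) := by
    refine (integrable_const (1 : ℝ)).mono' (Measurable.aestronglyMeasurable
      ((by fun_prop : Measurable _).indicator measurableSet_Iio)) ?_
    filter_upwards [ae_pos_expMeasure_one] with a ha
    refine (norm_indicator_le_norm_self _ _).trans ?_
    rw [Real.norm_eq_abs, Real.abs_exp]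
    refine Real.exp_le_one_iff.2 ?_
    have : 0 ≤ s.Rp * s.Psmax * a := by positivity
    linarith
  simp_rw [hsplit]
  rw [integral_add ((integrable_const _).indicator measurableSet_Iio) (hint.const_mul _),
    integral_const_mul, integral_indicator_const _ measurableSet_Iio,
    expMeasure_one_real_Iio hc.le, integral_indicator_exp_expMeasure_one hr.le hc.le, smul_eq_mul,
    Mavg]
  -- Every exponential is expressed through those of c, R_p K and -R_p, using c P_{s,max} = K. The
  -- identity then becomes rational.
  have e1 : Real.exp (s.K * (s.Rp * s.Psmax + 1) / s.Psmax) =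
      Real.exp s.gainThreshold * Real.exp (s.Rp * s.K) := by
    rw [← Real.exp_add, gainThreshold]
    congr 1
    field_simp
    ring
  have e2 : Real.exp (-s.Rp * (1 + s.K)) = Real.exp (-s.Rp) * (Real.exp (s.Rp * s.K))⁻¹ := by
    rw [← Real.exp_neg, ← Real.exp_add]
    congr 1
    ring
  have e3 : Real.exp (-((1 + s.Rp * s.Psmax) * s.gainThreshold)) =
      (Real.exp s.gainThreshold)⁻¹ * (Real.exp (s.Rp * s.K))⁻¹ := by
    rw [← Real.exp_neg, ← Real.exp_neg, ← Real.exp_add, gainThreshold]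
    congr 1
    field_simp
    ring
  have h1 : Real.exp s.gainThreshold - 1 ≠ 0 := by
    have : 1 < Real.exp s.gainThreshold := by simpa using hc
    linarith
  rw [Real.exp_neg s.gainThreshold] at hq ⊢
  rw [e1, e2, e3, ← gainThreshold]
  have h2 := Real.exp_pos s.gainThreshold
  have h3 := Real.exp_pos (s.Rp * s.K)
  have h5 : 1 - (Real.exp s.gainThreshold)⁻¹ =
      (Real.exp s.gainThreshold - 1) / Real.exp s.gainThreshold := by
    field_simp
  rw [h5]
  field_simp
  ring

theorem setIntegral_selectedDeparture_compl_noCandidate (hPp : 0 < s.Pp) (hR : 0 < s.R)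
    (hPs : 0 < s.Psmax) (hK : 0 < s.K) (N : ℕ) :
    ∫ x in (noCandidate s.gainThreshold N)ᶜ, s.selectedDeparture N x ∂gainLaw =
      s.Mavg * gainLaw.real (noCandidate s.gainThreshold N)ᶜ := by
  rw [← integral_indicator_saturatedDeparture hPp hR hPs hK,
    ← sum_setIntegral_isBest (gainThreshold_pos hPs hK) N measurable_saturatedDeparture]
  have hint : ∀ i, Integrable ((isBest s.gainThreshold N i).indicator
      fun x => s.saturatedDeparture (x (.interf i))) gainLaw := fun i =>
    (integrable_comp_eval_gainLaw (integrable_saturatedDeparture hPp hR hPs)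
      (.interf i)).indicator (measurableSet_isBest _ N i)
  rw [setIntegral_congr_fun (g := fun x => ∑ i ∈ Finset.range N, (isBest s.gainThreshold N i).indicator
      (fun x => s.saturatedDeparture (x (.interf i))) x) (measurableSet_noCandidate _ N).compl,
    integral_finsetSum _ fun i _ => (hint i).integrableOn]
  · refine Finset.sum_congr rfl fun i hi => ?_
    rw [setIntegral_indicator (measurableSet_isBest _ N i), inter_eq_self_of_subset_right
      (isBest_subset_compl_noCandidate (Finset.mem_range.1 hi))]
  · intro x hx
    simp only [selectedDeparture]
    rw [indicator_of_notMem hx, zero_add]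

/-- Rate of the selected transmitter without primary interference. -/
noncomputable def selectedRateIdle (s : Params) (N : ℕ) (x : Link → ℝ) : ℝ :=
  Real.logb 2 (1 + s.selectedSNR N x)

/-- Rate of the selected transmitter under primary interference. -/
noncomputable def selectedRateBusy (s : Params) (N : ℕ) (x : Link → ℝ) : ℝ :=
  Real.logb 2 (1 + s.selectedSNR N x / (1 + x .primary * s.Pp))

theorem measurable_selectedRateIdle (N : ℕ) : Measurable (s.selectedRateIdle N) := by
  have := measurable_selectedSNR (s := s) N
  unfold selectedRateIdle Real.logb
  fun_prop

theorem measurable_selectedRateBusy (N : ℕ) : Measurable (s.selectedRateBusy N) := by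
  have := measurable_selectedSNR (s := s) N
  unfold selectedRateBusy Real.logb
  fun_prop

theorem selectedRateIdle_nonneg (hPs : 0 < s.Psmax) (N : ℕ) (x : Link → ℝ) :
    0 ≤ s.selectedRateIdle N x :=
  Real.logb_nonneg one_lt_two (by linarith [selectedSNR_nonneg hPs N x])

theorem ae_selectedRateBusy_mem_Icc (hPp : 0 < s.Pp) (hPs : 0 < s.Psmax) (N : ℕ) :
    ∀ᵐ x ∂gainLaw, s.selectedRateBusy N x ∈ Icc 0 (s.selectedRateIdle N x) := by
  filter_upwards [ae_pos_gainLaw] with x hx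
  have h0 := selectedSNR_nonneg hPs N x
  have hz := hx .primary
  have h1 : 0 ≤ s.selectedSNR N x / (1 + x .primary * s.Pp) := by positivity
  refine ⟨Real.logb_nonneg one_lt_two (by linarith),
    Real.logb_le_logb_of_le one_lt_two (by linarith) ?_⟩
  gcongr
  exact div_le_self h0 (by nlinarith)

theorem ae_selectedRateIdle_le (hPs : 0 < s.Psmax) (N : ℕ) : ∀ᵐ x ∂gainLaw,
    s.selectedRateIdle N x ≤
      s.Psmax / Real.log 2 * ∑ i ∈ Finset.range N, x (.forward i) := by
  filter_upwards [ae_selectedSNR_le hPs N] with x hx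
  have hlog : 0 < Real.log 2 := Real.log_pos one_lt_two
  rw [selectedRateIdle, Real.logb, div_mul_eq_mul_div]
  gcongr
  exact (log_one_add_le_self (selectedSNR_nonneg hPs N x)).trans hx

theorem integrable_selectedRateIdle (hPs : 0 < s.Psmax) (N : ℕ) :
    Integrable (s.selectedRateIdle N) gainLaw := by
  refine ((integrable_sum_forward N).const_mul (s.Psmax / Real.log 2)).mono'
    (measurable_selectedRateIdle N).aestronglyMeasurable ?_
  filter_upwards [ae_selectedRateIdle_le hPs N] with x hx
  rwa [Real.norm_of_nonneg (selectedRateIdle_nonneg hPs N x)]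

theorem integrable_selectedRateBusy (hPp : 0 < s.Pp) (hPs : 0 < s.Psmax) (N : ℕ) :
    Integrable (s.selectedRateBusy N) gainLaw := by
  refine (integrable_selectedRateIdle hPs N).mono'
    (measurable_selectedRateBusy N).aestronglyMeasurable ?_
  filter_upwards [ae_selectedRateBusy_mem_Icc hPp hPs N] with x hx
  rw [Real.norm_of_nonneg hx.1]
  exact hx.2

/-- The rate is at most a multiple of the sum of all forward gains. These are independent of the
event, which concerns interference gains only, so each contributes the probability e^{-cN}. -/
theorem setIntegral_selectedRateIdle_le (hPs : 0 < s.Psmax) (hK : 0 < s.K) (N : ℕ) :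
    ∫ x in noCandidate s.gainThreshold N, s.selectedRateIdle N x ∂gainLaw ≤
      s.Psmax / Real.log 2 * (N * Real.exp (-s.gainThreshold) ^ N) := by
  have hm := measurableSet_noCandidate s.gainThreshold N
  calc ∫ x in noCandidate s.gainThreshold N, s.selectedRateIdle N x ∂gainLaw
      ≤ ∫ x in noCandidate s.gainThreshold N,
          s.Psmax / Real.log 2 * ∑ i ∈ Finset.range N, x (.forward i) ∂gainLaw :=
        setIntegral_mono_ae (integrable_selectedRateIdle hPs N).integrableOn
          ((integrable_sum_forward N).const_mul _).integrableOn (ae_selectedRateIdle_le hPs N)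
    _ = _ := by
        rw [integral_const_mul, integral_finsetSum _ fun i _ =>
          (integrable_comp_eval_gainLaw integrable_id_expMeasure_one (.forward i)).integrableOn]
        have h : ∀ i, ∫ x in noCandidate s.gainThreshold N, x (.forward i) ∂gainLaw =
            Real.exp (-s.gainThreshold) ^ N := fun i => by
          rw [setIntegral_gainLaw_of_dependsOn (φ := fun y => y) measurable_id hm
            (dependsOn_noCandidate _ N) (by simp), integral_id_expMeasure_one, one_mul,
            gainLaw_real_noCandidate (gainThreshold_pos hPs hK).le]
        simp [h]

/-- Without candidates the best gain is 0 and the logarithm vanishes, so the integral extends to the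
whole space. -/
theorem setIntegral_compl_selectedRateIdle (N : ℕ) :
    ∫ x in (noCandidate s.gainThreshold N)ᶜ, s.selectedRateIdle N x ∂gainLaw =
      (∫ x, Real.log (1 + s.Psmax * bestGain s.gainThreshold N x) ∂gainLaw) / Real.log 2 := by
  rw [← integral_div, ← integral_indicator (measurableSet_noCandidate _ N).compl]
  congr 1
  ext x
  by_cases hx : x ∈ noCandidate s.gainThreshold N
  · rw [indicator_of_notMem (by simpa using hx), bestGain_eq_zero hx]
    simp
  · rw [indicator_of_mem hx, selectedRateIdle, selectedSNR_of_notMem hx, Real.logb]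

theorem setIntegral_compl_selectedRateBusy (N : ℕ) :
    ∫ x in (noCandidate s.gainThreshold N)ᶜ, s.selectedRateBusy N x ∂gainLaw =
      (∫ x, Real.log (1 + s.Psmax * bestGain s.gainThreshold N x / (1 + x .primary * s.Pp))
        ∂gainLaw) / Real.log 2 := by
  rw [← integral_div, ← integral_indicator (measurableSet_noCandidate _ N).compl]
  congr 1
  ext x
  by_cases hx : x ∈ noCandidate s.gainThreshold N
  · rw [indicator_of_notMem (by simpa using hx), bestGain_eq_zero hx]
    simp
  · rw [indicator_of_mem hx, selectedRateBusy, selectedSNR_of_notMem hx, Real.logb]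

end Params

/-! ### Transfer to the probability space of the model -/

section Transfer

variable {Ω : Type*} [MeasurableSpace Ω] {P : Measure Ω} {G : Ω → Link → ℝ}

theorem measureReal_eq_of_hasLaw (hG : HasLaw G gainLaw P) {A : Set Ω} {B : Set (Link → ℝ)}
    (hB : MeasurableSet B) (hAB : A =ᵐ[P] G ⁻¹' B) : P.real A = gainLaw.real B := by
  rw [measureReal_congr hAB, ← hG.map_eq, map_measureReal_apply_of_aemeasurable hG.aemeasurable hB]

theorem setIntegral_eq_of_hasLaw (hG : HasLaw G gainLaw P) {A : Set Ω} {B : Set (Link → ℝ)}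
    (hB : MeasurableSet B) (hAB : A =ᵐ[P] G ⁻¹' B) {f : Ω → ℝ} {F : (Link → ℝ) → ℝ}
    (hF : Measurable F) (hfF : f =ᵐ[P] F ∘ G) :
    ∫ ω in A, f ω ∂P = ∫ x in B, F x ∂gainLaw := by
  rw [Measure.restrict_congr_set hAB, integral_congr_ae (ae_restrict_of_ae hfF), ← hG.map_eq,
    setIntegral_map hB hF.aestronglyMeasurable hG.aemeasurable]
  rfl

theorem integrable_of_hasLaw (hG : HasLaw G gainLaw P) {f : Ω → ℝ} {F : (Link → ℝ) → ℝ}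
    (hF : Integrable F gainLaw) (hfF : f =ᵐ[P] F ∘ G) : Integrable f P := by
  rw [← hG.map_eq] at hF
  exact (hF.comp_aemeasurable hG.aemeasurable).congr hfF.symm

theorem integral_cond_eq (P : Measure Ω) (A : Set Ω) (f : Ω → ℝ) :
    ∫ ω, f ω ∂P[|A] = (P.real A)⁻¹ * ∫ ω in A, f ω ∂P := by
  rw [ProbabilityTheory.cond, integral_smul_measure, ENNReal.toReal_inv, smul_eq_mul,
    Measure.real]

namespace Params

variable {s : Params}

/-- Contribution of an event on which the mean departure rate is `D`. -/
theorem measureReal_mul_condCapacity {g : Link → Ω → ℝ} {σ : Ω → ℕ} {A : Set Ω}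
    (hA : P.real A ≠ 0) {D : ℝ} (hD : ∫ ω in A, s.schedDeparture g σ ω ∂P = D * P.real A) :
    P.real A * s.condCapacity P g σ A = s.meanCapacity (s.lam / D)
      (∫ ω in A, s.schedRateBusy g σ ω ∂P) (∫ ω in A, s.schedRateIdle g σ ω ∂P) := by
  simp only [condCapacity, meanCapacity, integral_cond_eq, hD]
  -- The normalization cancels inside the busy fraction, which becomes λ/D. In the rates it cancels
  -- against the outer factor.
  rw [mul_comm D, inv_mul_cancel_left₀ hA]
  field_simp

theorem schedule_ae_eq (hPp : 0 < s.Pp) (hR : 0 < s.R) (hPs : 0 < s.Psmax)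
    (hpd1 : s.pd < 1) (hmu : s.pd * Real.exp (-s.Rp) < s.muMin) (hK : 0 < s.K)
    {g : Link → Ω → ℝ} (hG : HasLaw (fun ω l => g l ω) gainLaw P) {N : ℕ} {σ : Ω → ℕ}
    (hσ : ∀ᵐ ω ∂P,
      s.IsTwoStageChoice N (fun i => g (.interf i) ω) (fun i => g (.forward i) ω) (σ ω)) :
    s.schedDeparture g σ =ᵐ[P] s.selectedDeparture N ∘ (fun ω l => g l ω) ∧
    s.schedRateBusy g σ =ᵐ[P] s.selectedRateBusy N ∘ (fun ω l => g l ω) ∧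
    s.schedRateIdle g σ =ᵐ[P] s.selectedRateIdle N ∘ (fun ω l => g l ω) := by
  have hpos := ae_pos_gainLaw
  have hne := ae_ne_gainLaw
  rw [← hG.map_eq] at hpos hne
  have hpos := ae_of_ae_map hG.aemeasurable hpos
  have hne := ae_of_ae_map hG.aemeasurable hne
  refine ⟨?_, ?_, ?_⟩ <;> filter_upwards [hσ, hpos, hne] with ω h hx hn
  · exact departureRate_eq_selectedDeparture hPp hR hPs hpd1 hmu hK
      (x := fun l => g l ω) hx hn h
  · simp only [schedRateBusy, rateBusy, Function.comp, selectedRateBusy,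
      ← snr_eq_selectedSNR hPs (x := fun l => g l ω) hx h]
  · simp only [schedRateIdle, rateIdle, Function.comp, selectedRateIdle,
      ← snr_eq_selectedSNR hPs (x := fun l => g l ω) hx h]

theorem unsaturated_ae_eq (hPs : 0 < s.Psmax) {g : Link → Ω → ℝ}
    (hG : HasLaw (fun ω l => g l ω) gainLaw P) (N : ℕ) :
    s.unsaturated g N =ᵐ[P] (fun ω l => g l ω) ⁻¹' noCandidate s.gainThreshold N := by
  have hpos := ae_pos_gainLaw
  rw [← hG.map_eq] at hpos
  refine Filter.eventuallyEq_set.2 ?_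
  filter_upwards [ae_of_ae_map hG.aemeasurable hpos] with ω hx
  exact (mem_noCandidate_iff hPs (x := fun l => g l ω) hx N).symm

/-- The identity is exact. It needs both conditioning events to have positive probability, which for
the presence of a candidate requires N ≥ 1. -/
theorem avgCapacity_eq (hPp : 0 < s.Pp) (hR : 0 < s.R) (hPs : 0 < s.Psmax)
    (hpd1 : s.pd < 1) (hmu : s.pd * Real.exp (-s.Rp) < s.muMin) (hK : 0 < s.K)
    {g : Link → Ω → ℝ} (hG : HasLaw (fun ω l => g l ω) gainLaw P) {N : ℕ} (hN : 1 ≤ N)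
    {σ : Ω → ℕ} (hσ : ∀ᵐ ω ∂P,
      s.IsTwoStageChoice N (fun i => g (.interf i) ω) (fun i => g (.forward i) ω) (σ ω)) :
    s.avgCapacity P g N σ =
      s.meanCapacity (s.lam / s.muMin)
        (∫ x in noCandidate s.gainThreshold N, s.selectedRateBusy N x ∂gainLaw)
        (∫ x in noCandidate s.gainThreshold N, s.selectedRateIdle N x ∂gainLaw) +
      s.meanCapacity (s.lam / s.Mavg)
        (∫ x in (noCandidate s.gainThreshold N)ᶜ, s.selectedRateBusy N x ∂gainLaw)
        (∫ x in (noCandidate s.gainThreshold N)ᶜ, s.selectedRateIdle N x ∂gainLaw) := by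
  obtain ⟨h1, h2, h3⟩ := schedule_ae_eq hPp hR hPs hpd1 hmu hK hG hσ
  have hc := gainThreshold_pos hPs hK
  have hm := measurableSet_noCandidate s.gainThreshold N
  have hu := unsaturated_ae_eq hPs hG N
  have hu' : ((s.unsaturated g N)ᶜ : Set Ω) =ᵐ[P]
      ((fun ω l => g l ω) ⁻¹' (noCandidate s.gainThreshold N)ᶜ : Set Ω) := hu.compl
  have hP := measureReal_eq_of_hasLaw hG hm hu
  have hP' := measureReal_eq_of_hasLaw hG hm.compl hu'
  have hne : gainLaw.real (noCandidate s.gainThreshold N) ≠ 0 := by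
    rw [gainLaw_real_noCandidate hc.le]
    positivity
  have hne' : gainLaw.real (noCandidate s.gainThreshold N)ᶜ ≠ 0 := by
    rw [probReal_compl_eq_one_sub hm, gainLaw_real_noCandidate hc.le]
    have h1 : Real.exp (-s.gainThreshold) < 1 := by simpa using hc
    have := pow_lt_one₀ (Real.exp_nonneg _) h1 (by omega : N ≠ 0)
    linarith
  rw [avgCapacity, measureReal_mul_condCapacity (D := s.muMin) (by rwa [hP]),
    measureReal_mul_condCapacity (D := s.Mavg) (by rwa [hP']),
    setIntegral_eq_of_hasLaw hG hm hu (measurable_selectedRateBusy N) h2,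
    setIntegral_eq_of_hasLaw hG hm hu (measurable_selectedRateIdle N) h3,
    setIntegral_eq_of_hasLaw hG hm.compl hu' (measurable_selectedRateBusy N) h2,
    setIntegral_eq_of_hasLaw hG hm.compl hu' (measurable_selectedRateIdle N) h3]
  · rw [hP', setIntegral_eq_of_hasLaw hG hm.compl hu' (measurable_selectedDeparture N) h1,
      setIntegral_selectedDeparture_compl_noCandidate hPp hR hPs hK]
  · rw [hP, setIntegral_eq_of_hasLaw hG hm hu (measurable_selectedDeparture N) h1,
      setIntegral_selectedDeparture_noCandidate]

end Params

end Transfer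

/-! ### Asymptotics -/

theorem tendsto_inv_one_add_mul_sub_log {p : ℝ} (hp : 0 < p) :
    Tendsto (fun d : ℝ => 1 / (1 + p * (d - Real.log d))) atTop (𝓝 0) := by
  have h1 : Tendsto (fun d : ℝ => d - Real.log d) atTop atTop := by
    refine tendsto_atTop_mono' _ ?_ (tendsto_id.atTop_div_const (two_pos : (0 : ℝ) < 2))
    -- Eventually ln d ≤ d/2, so d - ln d dominates d/2.
    filter_upwards [Real.isLittleO_log_id_atTop.bound (by norm_num : (0 : ℝ) < 1 / 2),
      eventually_ge_atTop 0] with d hd hd0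
    simp only [id, Real.norm_eq_abs, abs_of_nonneg hd0] at hd ⊢
    linarith [le_abs_self (Real.log d)]
  simp_rw [one_div]
  exact tendsto_inv_atTop_zero.comp
    (tendsto_atTop_add_const_left _ 1 (h1.const_mul_atTop hp))

/-- The difference is the logarithm of 1 - p ln d/(1 + pd), which tends to log 1, minus a logarithm
damped by e^{-d}. -/
theorem tendsto_log_sub_log_mul {p : ℝ} (hp : 0 < p) :
    Tendsto (fun d : ℝ => Real.log (1 + p * (d - Real.log d)) * (1 - Real.exp (-d)) -
      Real.log (1 + p * d)) atTop (𝓝 0) := by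
  have hr : Tendsto (fun d : ℝ => 1 - p * Real.log d / (1 + p * d)) atTop (𝓝 1) := by
    have h : Tendsto (fun d : ℝ => p * Real.log d / (1 + p * d)) atTop (𝓝 0) := by
      refine squeeze_zero' (g := fun d => Real.log d / d) ?_ ?_
        Real.isLittleO_log_id_atTop.tendsto_div_nhds_zero
      · filter_upwards [eventually_ge_atTop 1] with d hd
        have := Real.log_nonneg hd
        positivity
      · filter_upwards [eventually_ge_atTop 1] with d hd
        have := Real.log_nonneg hd
        rw [div_le_div_iff₀ (by positivity) (by positivity)]
        nlinarith
    simpa using h.const_sub 1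
  have h1 : Tendsto (fun d : ℝ => Real.log (1 - p * Real.log d / (1 + p * d))) atTop (𝓝 0) := by
    simpa using hr.log one_ne_zero
  have h2 : Tendsto (fun d : ℝ => Real.log (1 + p * (d - Real.log d)) * Real.exp (-d))
      atTop (𝓝 0) := by
    refine squeeze_zero' (g := fun d => p * ((d + 0) * Real.exp (-d))) ?_ ?_
      (by simpa using (tendsto_add_mul_exp_neg 0).const_mul p)
    · filter_upwards [eventually_gt_atTop 0] with d hd
      have hd' : 0 < d - Real.log d := by linarith [Real.log_le_sub_one_of_pos hd]
      exact mul_nonneg (Real.log_nonneg (by nlinarith)) (Real.exp_nonneg _)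
    · filter_upwards [eventually_ge_atTop 1] with d hd
      have hd' : 0 < d - Real.log d := by
        linarith [Real.log_le_sub_one_of_pos (by linarith : 0 < d)]
      rw [← mul_assoc, add_zero]
      gcongr
      refine (log_one_add_le_self (by positivity)).trans ?_
      gcongr
      linarith [Real.log_nonneg hd]
  have h3 := h1.sub h2
  rw [sub_zero] at h3
  refine h3.congr' ?_
  filter_upwards [eventually_gt_atTop 0] with d hd
  have hd' : 0 < d - Real.log d := by linarith [Real.log_le_sub_one_of_pos hd]
  have h4 : 0 < 1 + p * d := by positivity
  have h5 : 0 < 1 + p * (d - Real.log d) := by positivity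
  rw [show 1 - p * Real.log d / (1 + p * d) = (1 + p * (d - Real.log d)) / (1 + p * d) by
    field_simp
    ring, Real.log_div h5.ne' h4.ne']
  ring

/-- The equation w e^w = y has a root in [0, y] because y ≤ y e^y. For y ≥ 0 any root is
nonnegative, and w e^w is increasing there, which gives the lower bound. -/
theorem lambertW_mem_Icc {c y : ℝ} (hc : 0 ≤ c) (hy : c * Real.exp c ≤ y) :
    lambertW y ∈ Icc c y := by
  have hy0 : 0 ≤ y := le_trans (by positivity) hy
  have hmem : y ∈ (fun w : ℝ => w * Real.exp w) '' Ici (-1) := by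
    have hcont : ContinuousOn (fun w : ℝ => w * Real.exp w) (Icc 0 y) := by fun_prop
    have hsub := intermediate_value_Icc hy0 hcont
    have : y ∈ Icc ((fun w : ℝ => w * Real.exp w) 0) ((fun w : ℝ => w * Real.exp w) y) := by
      refine ⟨by simpa using hy0, ?_⟩
      exact le_mul_of_one_le_right hy0 (Real.one_le_exp hy0)
    obtain ⟨w, hw, hwy⟩ := hsub this
    exact ⟨w, mem_Ici.2 (by linarith [hw.1]), hwy⟩
  have heq : lambertW y * Real.exp (lambertW y) = y := Function.invFunOn_eq hmem
  have hnn : 0 ≤ lambertW y := by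
    by_contra h
    have := mul_neg_of_neg_of_pos (not_le.1 h) (Real.exp_pos (lambertW y))
    linarith
  refine ⟨?_, ?_⟩
  · by_contra h
    have h := not_le.1 h
    have : lambertW y * Real.exp (lambertW y) < c * Real.exp c :=
      mul_lt_mul'' h (Real.exp_lt_exp.2 h) hnn (Real.exp_nonneg _)
    linarith
  · calc lambertW y ≤ lambertW y * Real.exp (lambertW y) :=
        le_mul_of_one_le_right hnn (Real.one_le_exp hnn)
      _ = y := heq

/-! ### Decay of the weight against linear growth -/

namespace Params

variable {s : Params}

/-- From ln x ≥ 1 - 1/x at x = 1 - 1/N follows (N - 1) ln(1 - 1/N) ≥ -1. The exponent is therefore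
at most -c(N - 1). -/
theorem weight_le (hPs : 0 < s.Psmax) (hK : 0 < s.K) {N : ℕ} (hN : 2 ≤ N) :
    s.weight N ≤ Real.exp s.gainThreshold * Real.exp (-s.gainThreshold) ^ N := by
  have hc := gainThreshold_pos hPs hK
  have hN2 : (2 : ℝ) ≤ N := by exact_mod_cast hN
  have hx : 0 < 1 - 1 / (N : ℝ) := by
    rw [sub_pos, div_lt_one (by linarith)]
    linarith
  have hlog : Real.log (1 - 1 / (N : ℝ)) < 0 := by
    refine Real.log_neg hx ?_
    have : 0 < 1 / (N : ℝ) := by positivity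
    linarith
  have hlow : -1 ≤ (N - 1) * Real.log (1 - 1 / (N : ℝ)) := by
    have h := Real.one_sub_inv_le_log_of_pos hx
    have e : 1 - (1 - 1 / (N : ℝ))⁻¹ = -1 / (N - 1) := by
      have : (N : ℝ) - 1 ≠ 0 := by linarith
      have h1 : 1 - 1 / (N : ℝ) = (N - 1) / N := by field_simp
      rw [h1, inv_div]
      field_simp
      ring
    rw [e, div_le_iff₀ (by linarith)] at h
    linarith
  rw [weight, ← Real.exp_nat_mul, ← Real.exp_add, Real.exp_le_exp, ← div_div,
    ← gainThreshold, div_le_iff_of_neg hlog]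
  nlinarith

theorem tendsto_weight_mul_affine (hPs : 0 < s.Psmax) (hK : 0 < s.K) (A B : ℝ) :
    Tendsto (fun N : ℕ => s.weight N * (A + B * N)) atTop (𝓝 0) := by
  have hc := gainThreshold_pos hPs hK
  have hr0 := Real.exp_nonneg (-s.gainThreshold)
  have hr1 : Real.exp (-s.gainThreshold) < 1 := by simpa using hc
  have h1 := tendsto_pow_atTop_nhds_zero_of_lt_one hr0 hr1
  have h2 := tendsto_self_mul_const_pow_of_lt_one hr0 hr1
  have h3 := ((h1.const_mul |A|).add (h2.const_mul |B|)).const_mul (Real.exp s.gainThreshold)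
  rw [mul_zero, mul_zero, add_zero, mul_zero] at h3
  refine squeeze_zero_norm' ?_ h3
  filter_upwards [eventually_ge_atTop 2] with N hN
  have hw := weight_le hPs hK hN
  have hw0 : 0 ≤ s.weight N := Real.exp_nonneg _
  rw [Real.norm_eq_abs, abs_mul, abs_of_nonneg hw0]
  have hA : |A + B * N| ≤ |A| + |B| * N := by
    refine (abs_add_le _ _).trans ?_
    rw [abs_mul, Nat.abs_cast]
  calc s.weight N * |A + B * N|
      ≤ Real.exp s.gainThreshold * Real.exp (-s.gainThreshold) ^ N * (|A| + |B| * N) := by gcongr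
    _ = _ := by ring

theorem tendsto_weight_mul_logb (hPs : 0 < s.Psmax) (hK : 0 < s.K) {u : ℕ → ℝ} {C : ℝ}
    (hu : ∀ᶠ N : ℕ in atTop, u N ∈ Icc 0 (C * N)) :
    Tendsto (fun N : ℕ => s.weight N * Real.logb 2 (1 + u N)) atTop (𝓝 0) := by
  refine squeeze_zero' (g := fun N : ℕ => s.weight N * (0 + C / Real.log 2 * N)) ?_ ?_
    (tendsto_weight_mul_affine hPs hK 0 _)
  · filter_upwards [hu] with N h
    exact mul_nonneg (Real.exp_nonneg _) (Real.logb_nonneg one_lt_two (by linarith [h.1]))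
  · filter_upwards [hu] with N h
    have hlog : 0 < Real.log 2 := Real.log_pos one_lt_two
    have hw0 : 0 ≤ s.weight N := Real.exp_nonneg _
    rw [zero_add, Real.logb, div_mul_eq_mul_div]
    gcongr
    exact (log_one_add_le_self h.1).trans h.2

/-- The argument of W is c e^c N, which is at least c e^c. Hence W ≥ c, and P_{s,max} c = K gives
nonnegativity; the upper bound is W(y) ≤ y. -/
theorem bLow_mem_Icc (hPs : 0 < s.Psmax) (hK : 0 < s.K) {N : ℕ} (hN : 1 ≤ N) :
    s.bLow N ∈ Icc 0 (s.K * Real.exp s.gainThreshold * N) := by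
  have hc := gainThreshold_pos hPs hK
  have hN1 : (1 : ℝ) ≤ N := by exact_mod_cast hN
  have hKc : s.K = s.Psmax * s.gainThreshold := by
    rw [gainThreshold]
    field_simp
  have hy : s.K * N / s.Psmax * Real.exp (s.K / s.Psmax) =
      s.gainThreshold * Real.exp s.gainThreshold * N := by
    rw [gainThreshold]
    ring
  have h := lambertW_mem_Icc hc.le (y := s.gainThreshold * Real.exp s.gainThreshold * N)
    (le_mul_of_one_le_right (by positivity) hN1)
  rw [bLow, hy]
  refine ⟨?_, ?_⟩
  · have := mul_le_mul_of_nonneg_left h.1 hPs.le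
    linarith
  · have := mul_le_mul_of_nonneg_left h.2 hPs.le
    rw [← mul_assoc, ← mul_assoc, ← hKc] at this
    linarith

/-- The centring constant `ln (N (1 - e^{-K / P_{s,max}}))` of the best gain. -/
noncomputable def gainCentre (s : Params) (N : ℕ) : ℝ :=
  Real.log (N * (1 - Real.exp (-s.gainThreshold)))

theorem one_sub_exp_neg_gainThreshold_pos (hPs : 0 < s.Psmax) (hK : 0 < s.K) :
    0 < 1 - Real.exp (-s.gainThreshold) := by
  have : Real.exp (-s.gainThreshold) < 1 := by simpa using gainThreshold_pos hPs hK
  linarith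

theorem exp_gainCentre (hPs : 0 < s.Psmax) (hK : 0 < s.K) {N : ℕ} (hN : 1 ≤ N) :
    N * (1 - Real.exp (-s.gainThreshold)) = Real.exp (s.gainCentre N) := by
  have hN1 : (1 : ℝ) ≤ N := by exact_mod_cast hN
  have hq := one_sub_exp_neg_gainThreshold_pos hPs hK
  rw [gainCentre, Real.exp_log (by positivity)]

theorem tendsto_gainCentre (hPs : 0 < s.Psmax) (hK : 0 < s.K) :
    Tendsto s.gainCentre atTop atTop :=
  Real.tendsto_log_atTop.comp (tendsto_natCast_atTop_atTop.atTop_mul_const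
    (one_sub_exp_neg_gainThreshold_pos hPs hK))

theorem tendsto_weight_mul_logb_gainCentre (hPs : 0 < s.Psmax) (hK : 0 < s.K) :
    Tendsto (fun N : ℕ => s.weight N * Real.logb 2 (1 + s.Psmax * s.gainCentre N))
      atTop (𝓝 0) := by
  refine tendsto_weight_mul_logb hPs hK (C := s.Psmax) ?_
  filter_upwards [(tendsto_gainCentre hPs hK).eventually_ge_atTop 0, eventually_ge_atTop 1]
    with N h hN
  refine ⟨by positivity, ?_⟩
  gcongr
  have h1 : N * (1 - Real.exp (-s.gainThreshold)) ≤ N :=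
    mul_le_of_le_one_right (by positivity) (by linarith [Real.exp_pos (-s.gainThreshold)])
  have h2 := Real.add_one_le_exp (s.gainCentre N)
  rw [← exp_gainCentre hPs hK hN] at h2
  linarith

/-! ### Limits of the averaged rates on the two events -/

theorem tendsto_setIntegral_selectedRateIdle (hPs : 0 < s.Psmax) (hK : 0 < s.K) :
    Tendsto (fun N => ∫ x in noCandidate s.gainThreshold N, s.selectedRateIdle N x ∂gainLaw)
      atTop (𝓝 0) := by
  have hr1 : Real.exp (-s.gainThreshold) < 1 := by simpa using gainThreshold_pos hPs hK
  refine squeeze_zero (fun N => integral_nonneg fun x => selectedRateIdle_nonneg hPs N x)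
    (fun N => setIntegral_selectedRateIdle_le hPs hK N) ?_
  simpa using (tendsto_self_mul_const_pow_of_lt_one (Real.exp_nonneg _) hr1).const_mul
    (s.Psmax / Real.log 2)

theorem tendsto_setIntegral_selectedRateBusy (hPp : 0 < s.Pp) (hPs : 0 < s.Psmax)
    (hK : 0 < s.K) :
    Tendsto (fun N => ∫ x in noCandidate s.gainThreshold N, s.selectedRateBusy N x ∂gainLaw)
      atTop (𝓝 0) := by
  refine squeeze_zero (fun N => ?_) (fun N => ?_) (tendsto_setIntegral_selectedRateIdle hPs hK)
  · refine integral_nonneg_of_ae (ae_restrict_of_ae ?_)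
    filter_upwards [ae_selectedRateBusy_mem_Icc hPp hPs N] with x hx using hx.1
  · refine setIntegral_mono_ae (integrable_selectedRateBusy hPp hPs N).integrableOn
      (integrable_selectedRateIdle hPs N).integrableOn ?_
    filter_upwards [ae_selectedRateBusy_mem_Icc hPp hPs N] with x hx using hx.2

theorem tendsto_integral_log_bestGain_sub (hPs : 0 < s.Psmax) (hK : 0 < s.K) :
    Tendsto (fun N => ∫ x, Real.log (1 + s.Psmax * bestGain s.gainThreshold N x) ∂gainLaw -
      Real.log (1 + s.Psmax * s.gainCentre N)) atTop (𝓝 0) := by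
  have hc := (gainThreshold_pos hPs hK).le
  have hd := tendsto_gainCentre hPs hK
  have hup : Tendsto (fun N => s.Psmax / (1 + s.Psmax * s.gainCentre N)) atTop (𝓝 0) :=
    tendsto_const_nhds.div_atTop (tendsto_atTop_add_const_left _ 1 (hd.const_mul_atTop hPs))
  refine tendsto_of_tendsto_of_tendsto_of_le_of_le' ((tendsto_log_sub_log_mul hPs).comp hd) hup
    ?_ ?_
  · filter_upwards [hd.eventually_gt_atTop 0, eventually_ge_atTop 1] with N h hN
    exact sub_le_sub_right
      (le_integral_log_one_add_bestGain hc hPs.le h (exp_gainCentre hPs hK hN)) _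
  · filter_upwards [hd.eventually_gt_atTop 0, eventually_ge_atTop 1] with N h hN
    rw [sub_le_iff_le_add']
    exact integral_log_one_add_bestGain_le hc hPs.le h.le (exp_gainCentre hPs hK hN)

theorem tendsto_setIntegral_compl_selectedRateIdle_sub (hPs : 0 < s.Psmax) (hK : 0 < s.K) :
    Tendsto (fun N => ∫ x in (noCandidate s.gainThreshold N)ᶜ, s.selectedRateIdle N x ∂gainLaw -
      Real.logb 2 (1 + s.Psmax * s.gainCentre N)) atTop (𝓝 0) := by
  have h := (tendsto_integral_log_bestGain_sub hPs hK).div_const (Real.log 2)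
  rw [zero_div] at h
  refine h.congr fun N => ?_
  rw [setIntegral_compl_selectedRateIdle, Real.logb, sub_div]

/-- The interference loss and the centring of the best gain are two separate vanishing errors. They
are added, then divided by ln 2 to change the base. -/
theorem tendsto_setIntegral_compl_selectedRateBusy_sub (hPp : 0 < s.Pp) (hPs : 0 < s.Psmax)
    (hK : 0 < s.K) :
    Tendsto (fun N => ∫ x in (noCandidate s.gainThreshold N)ᶜ, s.selectedRateBusy N x ∂gainLaw -
      (Real.logb 2 (1 + s.Psmax * s.gainCentre N) - s.interfLoss)) atTop (𝓝 0) := by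
  have hc := (gainThreshold_pos hPs hK).le
  have hd := tendsto_gainCentre hPs hK
  have hb : Tendsto (fun d : ℝ => s.Pp * (1 / (1 + s.Psmax * (d - Real.log d)) + Real.exp (-d)))
      atTop (𝓝 0) := by
    simpa using ((tendsto_inv_one_add_mul_sub_log hPs).add
      Real.tendsto_exp_neg_atTop_nhds_zero).const_mul s.Pp
  have h1 : Tendsto (fun N => ∫ x, Real.log (1 + s.Psmax * bestGain s.gainThreshold N x /
      (1 + x .primary * s.Pp)) ∂gainLaw -
        (∫ x, Real.log (1 + s.Psmax * bestGain s.gainThreshold N x) ∂gainLaw -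
          Real.exp (1 / s.Pp) * expIntegralE1 (1 / s.Pp))) atTop (𝓝 0) := by
    refine squeeze_zero_norm' ?_ (hb.comp hd)
    filter_upwards [hd.eventually_gt_atTop 0, eventually_ge_atTop 1] with N h hN
    exact abs_integral_log_one_add_bestGain_div_sub_le hc hPs.le hPp h (exp_gainCentre hPs hK hN)
  have h := (h1.add (tendsto_integral_log_bestGain_sub hPs hK)).div_const (Real.log 2)
  rw [add_zero, zero_div] at h
  refine h.congr fun N => ?_
  rw [setIntegral_compl_selectedRateBusy, Real.logb, interfLoss]
  ring

theorem tendsto_meanCapacity_zero (s : Params) (ρ : ℝ) {u v : ℕ → ℝ}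
    (hu : Tendsto u atTop (𝓝 0)) (hv : Tendsto v atTop (𝓝 0)) :
    Tendsto (fun N => s.meanCapacity ρ (u N) (v N)) atTop (𝓝 0) := by
  simpa [meanCapacity] using
    (hu.const_mul (ρ * (1 - s.pd))).add (hv.const_mul ((1 - ρ) * (1 - s.pf)))

end Params

end CognitiveRadio

theorem theorem1 (s : Params)
    (hpd0 : 0 ≤ s.pd) (hpd1 : s.pd < 1) (hpf0 : 0 ≤ s.pf) (hpf1 : s.pf ≤ 1)
    (hlam0 : 0 ≤ s.lam) (hlam1 : s.lam ≤ 1)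
    (hPp : 0 < s.Pp) (hPs : 0 < s.Psmax) (hR : 0 < s.R)
    (hmu : s.pd * Real.exp (-s.Rp) < s.muMin) (hK : 0 < s.K)
    {Ω : Type*} [MeasurableSpace Ω] (P : Measure Ω) [IsProbabilityMeasure P]
    (g : Link → Ω → ℝ) (hlaw : ∀ l, HasLaw (g l) (expMeasure 1) P) (hind : iIndepFun g P)
    (σ : ℕ → Ω → ℕ)
    (hσ : ∀ N, 1 ≤ N → ∀ᵐ ω ∂P,
      s.IsTwoStageChoice N (fun i => g (.interf i) ω) (fun i => g (.forward i) ω) (σ N ω)) :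
    -- the averages involved exist
    (∀ N, 1 ≤ N → Integrable (s.schedDeparture g (σ N)) P ∧
      Integrable (s.schedRateBusy g (σ N)) P ∧ Integrable (s.schedRateIdle g (σ N)) P) ∧
    -- the rates are lower bounds for those of the scheduler that maximizes the SNR
    (∀ N, 1 ≤ N → ∀ τ : Ω → ℕ,
      (∀ᵐ ω ∂P, s.IsLargestSNR N (fun i => g (.interf i) ω) (fun i => g (.forward i) ω) (τ ω)) →
      ∀ᵐ ω ∂P, s.schedRateBusy g (σ N) ω ≤ s.schedRateBusy g τ ω ∧
        s.schedRateIdle g (σ N) ω ≤ s.schedRateIdle g τ ω) ∧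
    -- asymptotics of the average capacity
    Tendsto (fun N : ℕ => s.avgCapacity P g N (σ N) - s.asympCapacity N) atTop (𝓝 0) := by
  have hG : HasLaw (fun ω l => g l ω) gainLaw P :=
    hind.hasLaw_infinitePi hlaw (aemeasurable_pi_iff.2 fun l => (hlaw l).aemeasurable)
  refine ⟨fun N hN => ?_, fun N hN τ hτ => ?_, ?_⟩
  · obtain ⟨h1, h2, h3⟩ := Params.schedule_ae_eq hPp hR hPs hpd1 hmu hK hG (hσ N hN)
    exact ⟨integrable_of_hasLaw hG (Params.integrable_selectedDeparture hPp hR hPs N) h1,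
      integrable_of_hasLaw hG (Params.integrable_selectedRateBusy hPp hPs N) h2,
      integrable_of_hasLaw hG (Params.integrable_selectedRateIdle hPs N) h3⟩
  · have hpos := ae_pos_gainLaw
    rw [← hG.map_eq] at hpos
    filter_upwards [hσ N hN, hτ, ae_of_ae_map hG.aemeasurable hpos] with ω h1 h2 hx
    have h0 := Params.snr_nonneg hPs (g (.interf (σ N ω)) ω) (hx (.forward (σ N ω)))
    have hle := h2.2 _ (Params.mem_range_of_isTwoStageChoice h1)
    have hz := hx .primary
    exact ⟨Params.rateBusy_mono (by positivity) h0 hle, Params.rateIdle_mono h0 hle⟩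
  · have hw : Tendsto s.weight atTop (𝓝 0) := by
      simpa using Params.tendsto_weight_mul_affine hPs hK 1 0
    have hwb : Tendsto (fun N => s.weight N * Real.logb 2 (1 + s.bLow N)) atTop (𝓝 0) :=
      Params.tendsto_weight_mul_logb hPs hK
        ((eventually_ge_atTop 1).mono fun N hN => Params.bLow_mem_Icc hPs hK hN)
    have hwl := Params.tendsto_weight_mul_logb_gainCentre hPs hK
    have hwε := hw.mul_const s.interfLoss
    rw [zero_mul] at hwε
    -- By linearity of `meanCapacity` in the rates, the difference is t1 + t2 - t3 + t4. Here t1 is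
    -- the part without candidates, t2 the error of the part with candidates, t3 the first term of
    -- the explicit expression, and t4 restores the share w_N missing from the weight 1 - w_N.
    have t1 := s.tendsto_meanCapacity_zero (s.lam / s.muMin)
      (Params.tendsto_setIntegral_selectedRateBusy hPp hPs hK)
      (Params.tendsto_setIntegral_selectedRateIdle hPs hK)
    have t2 := s.tendsto_meanCapacity_zero (s.lam / s.Mavg)
      (Params.tendsto_setIntegral_compl_selectedRateBusy_sub hPp hPs hK)
      (Params.tendsto_setIntegral_compl_selectedRateIdle_sub hPs hK)
    have t3 := s.tendsto_meanCapacity_zero (s.lam / s.muMin)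
      (by simpa using hwb.sub hwε) hwb
    have t4 := s.tendsto_meanCapacity_zero (s.lam / s.Mavg)
      (by simpa using hwl.sub hwε) hwl
    have h := ((t1.add t2).sub t3).add t4
    rw [add_zero, sub_zero, add_zero] at h
    refine h.congr' ?_
    filter_upwards [eventually_ge_atTop 1] with N hN
    have hl : Real.log (N * (1 - Real.exp (-s.K / s.Psmax))) = s.gainCentre N := by
      rw [Params.gainCentre, Params.gainThreshold, neg_div]
    rw [Params.avgCapacity_eq hPp hR hPs hpd1 hmu hK hG hN (hσ N hN), Params.asympCapacity, hl]
    simp only [Params.meanCapacity]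
    ring
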